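/- For strings $x,y$ over the binary alphabet $\{0,1\}$, not both empty, let $n=\max\{|x|,|y|\}$ and $m=\min\{|x|,|y|\}$, let $L$ be the length of a longest common subsequence (LCS) of $x$ and $y$, let $\delta=m-L$, and let $M=\#\{(i,j) : x[i]=y[j]\}$ be the number of matching pairs. The length $L$ of an LCS of two given binary strings $x,y$ can be computed in time $O(n+\delta M/n)$. It can also be computed in time $O(n+\delta\cdot\#_1(s))$, where $\#_1(s)$ is the number of ones in the shorter string $s$ of the two (say $s=y$ if $|x|=|y|$). Time is the number of instructions executed by a word RAM. That is, for each of the two bounds there are a fixed program and constants $c, C$ such that, for all such $x,y$ and all word sizes $w>\log_2 n+c$, the program stops with output $L$ after at most $C$ times the stated number of steps. -/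

import Mathlib

/-! Parameters of a pair of strings. -/

namespace LCS

/-- The lengths of the common subsequences of `x` and `y`. -/
def commonLengths {α : Type*} (x y : List α) : Set ℕ :=
  {k | ∃ z : List α, z.Sublist x ∧ z.Sublist y ∧ z.length = k}

/-- `L(x, y)`: the length of a longest common subsequence. -/
noncomputable def L {α : Type*} (x y : List α) : ℕ :=
  sSup (commonLengths x y)

/-- The supremum defining `L` is a maximum. -/
theorem L_isGreatest {α : Type*} (x y : List α) : IsGreatest (commonLengths x y) (L x y) := by
  have hne : (commonLengths x y).Nonempty :=
    ⟨0, [], List.nil_sublist x, List.nil_sublist y, rfl⟩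
  have hbdd : BddAbove (commonLengths x y) := by
    refine ⟨x.length, ?_⟩
    rintro k ⟨z, hzx, -, rfl⟩
    exact hzx.length_le
  exact ⟨Nat.sSup_mem hne hbdd, fun k hk => le_csSup hbdd hk⟩

/-- `n(x, y)`: the length of the longer string. -/
def n {α : Type*} (x y : List α) : ℕ := max x.length y.length

/-- `m(x, y)`: the length of the shorter string. -/
def m {α : Type*} (x y : List α) : ℕ := min x.length y.length

/-- `δ(x, y) = m - L`: the number of symbols to delete from the shorter string
(`L ≤ m`, so the subtraction does not truncate). -/
noncomputable def delta {α : Type*} (x y : List α) : ℕ := m x y - L x y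

/-- `M(x, y)`: the number of matching pairs `(i, j)`, `x[i] = y[j]`. -/
def M {α : Type*} [DecidableEq α] (x y : List α) : ℕ :=
  (Finset.univ.filter fun p : Fin x.length × Fin y.length => x.get p.1 = y.get p.2).card

/-- The shorter of the two strings (`y` if the lengths agree). -/
def shorter {α : Type*} (x y : List α) : List α := if y.length ≤ x.length then y else x

end LCS

/-! The word RAM: finitely many registers used by a fixed program, a random access memory, all
cells holding `w`-bit words (natural numbers below `2 ^ w`), unit cost per instruction. -/

namespace WordRAM

/-- The binary operations on words. -/
inductive BinOp where
  | add | sub | mul | div | mod | and | or | xor | shl | shr | lt | eq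

/-- The value of an operation on words of `w` bits (arithmetic is modulo `2 ^ w`; comparisons
give `0` or `1`). -/
def BinOp.eval (w : ℕ) (f : BinOp) (a b : ℕ) : ℕ :=
  match f with
  | .add => (a + b) % 2 ^ w
  | .sub => (a + 2 ^ w - b) % 2 ^ w
  | .mul => (a * b) % 2 ^ w
  | .div => (a / b) % 2 ^ w
  | .mod => (a % b) % 2 ^ w
  | .and => (a &&& b) % 2 ^ w
  | .or => (a ||| b) % 2 ^ w
  | .xor => (a ^^^ b) % 2 ^ w
  | .shl => (a * 2 ^ b) % 2 ^ w
  | .shr => (a / 2 ^ b) % 2 ^ w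
  | .lt => (if a < b then 1 else 0) % 2 ^ w
  | .eq => (if a = b then 1 else 0) % 2 ^ w

/-- The instructions; the arguments `d`, `a`, `b` are register names, `k` is a constant, and `l` is
a position in the program. -/
inductive Instr where
  /-- `reg d := k` -/
  | const (d k : ℕ)
  /-- `reg d := reg a` -/
  | move (d a : ℕ)
  /-- `reg d := f (reg a) (reg b)` -/
  | op (f : BinOp) (d a b : ℕ)
  /-- `reg d := mem (reg a)` -/
  | load (d a : ℕ)
  /-- `mem (reg a) := reg b` -/
  | store (a b : ℕ)
  /-- go to `l` -/
  | jump (l : ℕ)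
  /-- go to `l` if `reg a = 0` -/
  | jumpIfZero (a l : ℕ)
  /-- stop -/
  | halt

/-- A configuration: program counter, registers, memory. -/
@[ext]
structure Config where
  pc : ℕ
  reg : ℕ → ℕ
  mem : ℕ → ℕ

/-- The effect of a single instruction, `none` if it stops the machine. -/
def Instr.exec (w : ℕ) (s : Config) : Instr → Option Config
  | .const d k => some ⟨s.pc + 1, Function.update s.reg d (k % 2 ^ w), s.mem⟩
  | .move d a => some ⟨s.pc + 1, Function.update s.reg d (s.reg a), s.mem⟩
  | .op f d a b =>
      some ⟨s.pc + 1, Function.update s.reg d (f.eval w (s.reg a) (s.reg b)), s.mem⟩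
  | .load d a => some ⟨s.pc + 1, Function.update s.reg d (s.mem (s.reg a)), s.mem⟩
  | .store a b => some ⟨s.pc + 1, s.reg, Function.update s.mem (s.reg a) (s.reg b)⟩
  | .jump l => some ⟨l, s.reg, s.mem⟩
  | .jumpIfZero a l => some ⟨if s.reg a = 0 then l else s.pc + 1, s.reg, s.mem⟩
  | .halt => none

/-- One step of the program `P`, `none` if the machine has stopped (at `halt`, or past the end of
the program). -/
def step (w : ℕ) (P : List Instr) (s : Config) : Option Config :=
  P[s.pc]?.bind (Instr.exec w s)

/-- The configuration after `t` steps (a stopped machine stays where it is). -/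
def run (w : ℕ) (P : List Instr) (t : ℕ) (s : Config) : Config :=
  (fun s => (step w P s).getD s)^[t] s

/-- Started in `s`, the program `P` stops within `t` steps, with `v` in register `0`. -/
def HaltsWithin (w : ℕ) (P : List Instr) (s : Config) (t v : ℕ) : Prop :=
  step w P (run w P t s) = none ∧ (run w P t s).reg 0 = v

/-- The initial configuration on a pair of binary strings: `|x|` and `|y|` are in registers `0` and
`1`, the symbols of `x`, followed by those of `y`, are in the memory cells `0, 1, 2, …`, one
symbol per cell, and everything else is `0`. -/
def init (x y : List Bool) : Config where
  pc := 0
  reg := fun r => if r = 0 then x.length else if r = 1 then y.length else 0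
  mem := fun i => ((x ++ y).map Bool.toNat).getD i 0

end WordRAM

/-- The length of a longest common subsequence of two binary strings (not both empty) can be
computed in time `O(T(x, y))` on a word RAM with words of more than `log₂ n + c` bits, for some
constant `c`: one program, one `c` and one constant `C` in the time bound serve all inputs and all
these word sizes. -/
def BinaryLCSSolvableInTime (T : List Bool → List Bool → ℝ) : Prop :=
  ∃ (P : List WordRAM.Instr) (c : ℕ) (C : ℝ), ∀ (x y : List Bool) (w : ℕ),
    0 < LCS.n x y → 2 ^ c * LCS.n x y < 2 ^ w →
      ∃ t : ℕ, WordRAM.HaltsWithin w P (WordRAM.init x y) t (LCS.L x y) ∧ (t : ℝ) ≤ C * T x y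

/-! Let `k` be the smaller of the numbers of ones and of zeros in the shorter string `s`. One
program with running time `O(n + δ k)` gives both bounds: `k ≤ #₁(s)`, and `n k ≤ M`, because each
symbol of the longer string matches all ones or all zeros of `s`. Exchanging the two symbols does
not change `L`, so the ones of `s` may be taken to be the minority.

The dynamic program is indexed by deletions. For a suffix `ys` of `s` and a budget `d`, `row`
records how long a prefix of the longer string can be spared if at most `d` symbols of `ys` are
deleted. A new first symbol of `ys` is either deleted, which uses up one unit of the budget, or
matched with its last occurrence in the spared prefix (`le_row_iff`). The first budget for which the
row of `s` is defined is `δ` (`row_pos_iff`). Entries up to an index `K` depend only on entries up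
to `K`, so rows can be truncated. Doubling `K` until a defined entry appears costs no more, up to a
constant, than working with `K = δ + 1` from the start.

One row per symbol would be too slow, so a whole run of `a` zeros is treated in one pass of cost
`O(K)`. The choice is only how many zeros of the run to delete. Matching several zeros in succession
is one look-up in a table of zeros by rank. As this table is monotone, the best choice is found from
a maximum over a window of length `a` (`IsZeroTable.row_replicate`). A window meets at most two
blocks of length `a`, so prefix and suffix maxima of the blocks yield all window maxima in linear
time (`isGreatest_window`). There are `k + 1` runs, separated by `k` ones, hence the main phase
costs `O((δ + 1)(k + 1))`, which is `O(n + δ k)` because `δ, k ≤ n`.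

The algorithm is written in a small structured language with natural number arithmetic. Its
compilation to the word RAM is proved correct once (`Exec.run_code`), and time bounds are proved
with loop invariants and potentials (`Runs.loop`). -/

namespace LCS

/-! ### Rows of the dynamic program. -/

/-- For a prefix of length `R - 1` of `X` (`0` stands for no prefix at all), the same encoding of
the part of it before the last occurrence of `b`. -/
def prev (X : ℕ → Bool) (b : Bool) : ℕ → ℕ
  | 0 => 0
  | 1 => 0
  | p + 2 => if X p = b then p + 1 else prev X b (p + 1)

/-- The number of zeros among the first `R - 1` symbols of `X`. -/
def zeros (X : ℕ → Bool) : ℕ → ℕ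
  | 0 => 0
  | 1 => 0
  | p + 2 => zeros X (p + 1) + if X p = false then 1 else 0

/-- `row X N ys (d + 1)` encodes the longest prefix of `X` (of length `N`) whose removal leaves a
string that has a common subsequence with `ys` missing at most `d` symbols of `ys`. -/
def row (X : ℕ → Bool) (N : ℕ) : List Bool → ℕ → ℕ
  | [], i => if i = 0 then 0 else N + 1
  | b :: ys, i => max (row X N ys (i - 1)) (prev X b (row X N ys i))

variable {X : ℕ → Bool} {N : ℕ}

theorem le_prev_iff {b : Bool} {p R : ℕ} :
    p + 1 ≤ prev X b R ↔ ∃ q, p ≤ q ∧ q + 2 ≤ R ∧ X q = b := by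
  induction R using Nat.twoStepInduction with
  | zero => simp [prev]
  | one => simp [prev]
  | more r _ ih =>
    rw [prev]
    split_ifs with h
    · constructor
      · intro hp; exact ⟨r, by omega, le_rfl, h⟩
      · rintro ⟨q, h1, h2, -⟩; omega
    · rw [ih]
      constructor
      · rintro ⟨q, h1, h2, h3⟩; exact ⟨q, h1, by omega, h3⟩
      · rintro ⟨q, h1, h2, h3⟩
        refine ⟨q, h1, ?_, h3⟩
        have : q ≠ r := by rintro rfl; exact h h3
        omega

theorem prev_mono (b : Bool) : Monotone (prev X b) := by
  intro R R' h
  rcases hp : prev X b R with _ | p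
  · exact Nat.zero_le _
  · obtain ⟨q, h1, h2, h3⟩ := le_prev_iff.1 hp.ge
    exact le_prev_iff.2 ⟨q, h1, h2.trans h, h3⟩

theorem prev_le (b : Bool) (R : ℕ) : prev X b R ≤ R := by
  rcases hp : prev X b R with _ | p
  · exact Nat.zero_le _
  · obtain ⟨q, h1, h2, h3⟩ := le_prev_iff.1 hp.ge
    omega

theorem zeros_mono : Monotone (zeros X) := by
  apply monotone_nat_of_le_succ
  rintro (_ | p)
  · simp [zeros]
  · rw [zeros]; omega

theorem zeros_le (R : ℕ) : zeros X R ≤ R := by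
  induction R using zeros.induct with
  | case1 => simp [zeros]
  | case2 => simp [zeros]
  | case3 r ih => rw [zeros]; split_ifs <;> omega

/-- Index `0` stands for a budget of `-1`, which nothing meets. It makes the truncation in `i - 1`
harmless. -/
theorem row_zero (ys : List Bool) : row X N ys 0 = 0 := by
  induction ys with
  | nil => simp [row]
  | cons b ys ih => simp [row, ih, prev]

theorem row_le (ys : List Bool) (i : ℕ) : row X N ys i ≤ N + 1 := by
  induction ys generalizing i with
  | nil => simp only [row]; split_ifs <;> omega
  | cons b ys ih => exact max_le (ih _) ((prev_le _ _).trans (ih _))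

theorem cons_sublist_drop {x z : List Bool} {b : Bool} {p : ℕ} :
    (b :: z).Sublist (x.drop p) ↔
      ∃ q, p ≤ q ∧ q < x.length ∧ x.getD q false = b ∧ z.Sublist (x.drop (q + 1)) := by
  constructor
  · intro h
    induction hl : x.length - p generalizing p with
    | zero =>
      rw [List.drop_eq_nil_of_le (by omega)] at h
      cases h
    | succ l ih =>
      have hp : p < x.length := by omega
      rw [List.drop_eq_getElem_cons hp] at h
      cases h with
      | cons _ h =>
        obtain ⟨q, h1, h2⟩ := ih h (by omega)
        exact ⟨q, by omega, h2⟩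
      | cons_cons _ h =>
        exact ⟨p, le_rfl, hp, by simp [hp], h⟩
  · rintro ⟨q, h1, h2, h3, h4⟩
    have : (b :: z).Sublist (x.drop q) := by
      rw [List.drop_eq_getElem_cons h2]
      have : b = x[q] := by rw [← h3]; simp [h2]
      rw [this]
      exact h4.cons_cons _
    exact this.trans (List.drop_sublist_drop_left x h1)

/-- Induction on `ys`: a common subsequence of `b :: ys` either omits `b`, leaving a budget smaller
by one, or matches `b` at some `q ≥ p` and continues behind `q`. The two alternatives are the two
arguments of the maximum. -/
theorem le_row_iff {x : List Bool} (ys : List Bool) (p d : ℕ) :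
    p + 1 ≤ row (fun i => x.getD i false) x.length ys (d + 1) ↔
      p ≤ x.length ∧ ∃ z : List Bool, z.Sublist (x.drop p) ∧ z.Sublist ys ∧
        ys.length ≤ z.length + d := by
  induction ys generalizing p d with
  | nil => simp [row]
  | cons b ys ih =>
    rw [row, le_max_iff]
    constructor
    · rintro (h | h)
      · obtain _ | d := d
        · simp [row_zero] at h
        · obtain ⟨hp, z, h1, h2, h3⟩ := (ih p d).1 h
          exact ⟨hp, z, h1, h2.cons _, by simp; omega⟩
      · obtain ⟨q, h1, h2, h3⟩ := le_prev_iff.1 h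
        obtain ⟨hq, z, h4, h5, h6⟩ := (ih (q + 1) d).1 h2
        refine ⟨by omega, b :: z, ?_, h5.cons_cons _, by simp; omega⟩
        exact cons_sublist_drop.2 ⟨q, h1, hq, h3, h4⟩
    · rintro ⟨hp, z, h1, h2, h3⟩
      simp only [List.length_cons] at h3
      cases h2 with
      | cons _ h2 =>
        left
        have := h2.length_le
        obtain _ | d := d
        · omega
        · exact (ih p d).2 ⟨hp, z, h1, h2, by omega⟩
      | cons_cons _ h2 =>
        right
        obtain ⟨q, h4, h5, h6, h7⟩ := cons_sublist_drop.1 h1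
        refine le_prev_iff.2 ⟨q, h4, (ih (q + 1) d).2 ⟨h5, _, h7, h2, ?_⟩, h6⟩
        simp only [List.length_cons] at h3; omega

/-- The case `p = 0` of `le_row_iff`: nothing need be spared. The first positive index is therefore
the least number of deletions plus one. -/
theorem row_pos_iff {x : List Bool} (ys : List Bool) (i : ℕ) :
    0 < row (fun i => x.getD i false) x.length ys i ↔ ys.length + 1 ≤ L x ys + i := by
  have hL := L_isGreatest x ys
  obtain _ | d := i
  · have : L x ys ≤ ys.length := by
      obtain ⟨z, -, h, h'⟩ := hL.1
      exact h' ▸ h.length_le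
    simp [row_zero]; omega
  · have h := le_row_iff (x := x) ys 0 d
    rw [Nat.zero_add] at h
    rw [Nat.lt_iff_add_one_le, Nat.zero_add, h]
    constructor
    · rintro ⟨-, z, h1, h2, h3⟩
      have := hL.2 ⟨z, by simpa using h1, h2, rfl⟩
      omega
    · intro h3
      obtain ⟨z, h1, h2, h4⟩ := hL.1
      exact ⟨Nat.zero_le _, z, by simpa using h1, h2, by omega⟩

/-! ### A run of zeros in one step. -/

section ZeroRun

variable {ys : List Bool}

/-- One admissible strategy for the run: delete the `e` zeros next to `ys` and match the remaining
`a - e`. -/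
theorem prev_iterate_le_row (a i e : ℕ) (he : e ≤ a) :
    (prev X false)^[a - e] (row X N ys (i - e)) ≤
      row X N (List.replicate a false ++ ys) i := by
  induction a generalizing i e with
  | zero => obtain rfl : e = 0 := by omega
            simp
  | succ a ih =>
    rw [List.replicate_succ, List.cons_append, row]
    rcases Nat.lt_or_ge a e with h | h
    · obtain rfl : e = a + 1 := by omega
      have := ih (i - 1) a le_rfl
      refine le_max_of_le_left (le_trans (le_of_eq ?_) this)
      simp [Nat.sub_sub, Nat.add_comm]
    · rw [Nat.sub_add_comm h, Function.iterate_succ_apply']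
      exact le_max_of_le_right (prev_mono _ (ih i e h))

/-- Following the choice made by each maximum, only the number `e` of deletions matters, since the
symbols of the run are equal. -/
theorem exists_row_eq_prev_iterate (a i : ℕ) :
    ∃ e ≤ a, row X N (List.replicate a false ++ ys) i =
      (prev X false)^[a - e] (row X N ys (i - e)) := by
  induction a generalizing i with
  | zero => exact ⟨0, le_rfl, by simp⟩
  | succ a ih =>
    rw [List.replicate_succ, List.cons_append, row]
    rcases max_choice (row X N (List.replicate a false ++ ys) (i - 1))
      (prev X false (row X N (List.replicate a false ++ ys) i)) with h | h <;> rw [h]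
    · obtain ⟨e, he, h⟩ := ih (i - 1)
      refine ⟨e + 1, by omega, ?_⟩
      rw [h, show i - 1 - e = i - (e + 1) by omega, Nat.add_sub_add_right]
    · obtain ⟨e, he, h⟩ := ih i
      refine ⟨e, by omega, ?_⟩
      rw [h, Nat.sub_add_comm he, Function.iterate_succ_apply']

/-- `Q` lists the zeros of `X` by rank. -/
def IsZeroTable (X : ℕ → Bool) (N : ℕ) (Q : ℕ → ℕ) : Prop :=
  ∀ R ≤ N + 1, Q (zeros X R) = prev X false R

variable {Q : ℕ → ℕ}

theorem zeros_prev (R : ℕ) : zeros X (prev X false R) = zeros X R - 1 := by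
  induction R using Nat.twoStepInduction with
  | zero => simp [prev, zeros]
  | one => simp [prev, zeros]
  | more r _ ih =>
    rw [prev, zeros]
    split_ifs with h
    · simp
    · simp [ih]

/-- Each application of `prev X false` lowers the number of zeros by one, so after `b` of them the
next one is the look-up at rank `zeros X R - b`. -/
theorem IsZeroTable.iterate (hQ : IsZeroTable X N Q) {R : ℕ} (hR : R ≤ N + 1) (b : ℕ) :
    (prev X false)^[b + 1] R = Q (zeros X R - b) ∧
      zeros X ((prev X false)^[b + 1] R) = zeros X R - (b + 1) ∧
      (prev X false)^[b + 1] R ≤ N + 1 := by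
  induction b with
  | zero => exact ⟨(hQ R hR).symm, by simp [zeros_prev], (prev_le _ _).trans hR⟩
  | succ b ih =>
    obtain ⟨-, h2, h3⟩ := ih
    rw [Function.iterate_succ_apply', zeros_prev, h2]
    refine ⟨?_, by omega, (prev_le _ _).trans h3⟩
    rw [← hQ _ h3, h2]

/-- The entry of smaller rank arises from the other one by further applications of `prev`, which
never increase the value. -/
theorem IsZeroTable.mono (hQ : IsZeroTable X N Q) {R k k' : ℕ} (hR : R ≤ N + 1) (h : k ≤ k')
    (hk : k' ≤ zeros X R) : Q k ≤ Q k' := by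
  have h1 := (hQ.iterate hR (zeros X R - k)).1
  have h2 := (hQ.iterate hR (zeros X R - k')).1
  rw [show zeros X R - (zeros X R - k) = k by omega] at h1
  rw [show zeros X R - (zeros X R - k') = k' by omega] at h2
  rw [← h1, ← h2, show zeros X R - k + 1 = (k' - k) + (zeros X R - k' + 1) by omega,
    Function.iterate_add_apply]
  generalize (prev X false)^[zeros X R - k' + 1] R = S
  induction k' - k with
  | zero => simp
  | succ l ih => rw [Function.iterate_succ_apply']; exact (prev_le _ _).trans ih

/-- A row for a string that starts with a run of zeros, from a maximum over a window of the row
for the rest of the string. -/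
theorem IsZeroTable.row_replicate (hQ : IsZeroTable X N Q) {K a i w : ℕ} (ha : 0 < a)
    (hi : i ≤ K)
    (hw : IsGreatest ((fun j => zeros X (row X N ys j) + K - j) ''
      {j | i + 1 ≤ j + a ∧ j ≤ i}) w) :
    row X N (List.replicate a false ++ ys) i =
        max (row X N ys (i - a)) (Q (w + i + 1 - K - a)) ∧
      ∃ R ≤ N + 1, w + i + 1 - K - a ≤ zeros X R := by
  obtain ⟨⟨j, ⟨hj1, hj2⟩, hj⟩, hmax⟩ := hw
  simp only at hj
  have hrange : w + i + 1 - K - a ≤ zeros X (row X N ys j) := by omega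
  -- With `j = i - e` the rank is `(zeros + K - j) + i + 1 - K - a`. It depends on `j` only through
  -- the quantity maximized over the window, and adding `K` keeps that quantity from truncating.
  have hval : ∀ e < a, e ≤ i → (prev X false)^[a - e] (row X N ys (i - e)) =
      Q (zeros X (row X N ys (i - e)) + 1 + e - a) := by
    intro e he hei
    have := (hQ.iterate (row_le (X := X) ys (i - e)) (a - e - 1)).1
    rw [show a - e - 1 + 1 = a - e by omega] at this
    rw [this]
    congr 1
    omega
  refine ⟨le_antisymm ?_ (max_le ?_ ?_), _, row_le ys j, hrange⟩
  · obtain ⟨e, he, h⟩ := exists_row_eq_prev_iterate (X := X) (N := N) (ys := ys) a i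
    rw [h]
    rcases Nat.lt_or_ge e a with hea | hea
    · rcases Nat.lt_or_ge i e with hie | hie
      -- More deletions than the index allows: the row entry is `0`, a fixed point of `prev`.
      · rw [show i - e = 0 by omega, row_zero]
        have : ∀ l, (prev X false)^[l] 0 = 0 := fun l => Function.iterate_fixed (by simp [prev]) l
        simp [this]
      · rw [hval e hea hie]
        refine le_max_of_le_right (hQ.mono (row_le ys j) ?_ hrange)
        have := hmax ⟨i - e, ⟨by omega, by omega⟩, rfl⟩
        simp only at this
        omega
    · obtain rfl : e = a := by omega
      simp
  · simpa using prev_iterate_le_row (X := X) (N := N) (ys := ys) a i a le_rfl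
  · have h := prev_iterate_le_row (X := X) (N := N) (ys := ys) a i (i - j) (by omega)
    rw [hval (i - j) (by omega) (by omega), show i - (i - j) = j by omega] at h
    refine le_trans (le_of_eq ?_) h
    congr 1
    omega

end ZeroRun

/-! ### Window maxima from maxima over blocks. -/

section Window

variable {F : ℕ → ℕ} {a K : ℕ}

theorem succ_div_eq_iff (i a : ℕ) : (i + 1) / a = i / a ↔ (i + 1) % a ≠ 0 := by
  rw [Nat.succ_div]
  simp [Nat.dvd_iff_mod_eq_zero]

/-- Extending to the right a maximum over the part of a block up to `i`. -/
theorem isGreatest_block_succ {i v : ℕ} (h : IsGreatest (F '' {j | j ≤ i ∧ j / a = i / a}) v) :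
    IsGreatest (F '' {j | j ≤ i + 1 ∧ j / a = (i + 1) / a})
      (max (v * if 0 < (i + 1) % a then 1 else 0) (F (i + 1))) := by
  have hi := succ_div_eq_iff i a
  obtain ⟨⟨j, ⟨hj1, hj2⟩, rfl⟩, hmax⟩ := h
  -- The factor is `0` exactly when `i + 1` starts a new block. The maximum then restarts from `0`,
  -- which is neutral for natural numbers.
  split_ifs with hm
  · have hi := hi.2 hm.ne'
    refine ⟨?_, ?_⟩
    · rcases max_choice (F j * 1) (F (i + 1)) with h | h <;> rw [h]
      · exact ⟨j, ⟨by omega, by omega⟩, by simp⟩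
      · exact ⟨i + 1, ⟨le_rfl, rfl⟩, rfl⟩
    · rintro _ ⟨l, ⟨h1, h2⟩, rfl⟩
      rcases h1.lt_or_eq with h1 | rfl
      · exact le_max_of_le_left (by simpa using hmax ⟨l, ⟨by omega, by omega⟩, rfl⟩)
      · exact le_max_right _ _
  · have hi : (i + 1) / a ≠ i / a := fun h => hm (Nat.pos_of_ne_zero (hi.1 h))
    refine ⟨⟨i + 1, ⟨le_rfl, rfl⟩, by simp⟩, ?_⟩
    rintro _ ⟨l, ⟨h1, h2⟩, rfl⟩
    rcases h1.lt_or_eq with h1 | rfl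
    · have := Nat.div_le_div_right (c := a) (show l ≤ i by omega)
      have := Nat.div_le_div_right (c := a) (show i ≤ i + 1 by omega)
      omega
    · simp

/-- Extending to the left a maximum over the part of a block from `i + 1`. -/
theorem isGreatest_block_pred {i v : ℕ} (hK : i < K)
    (h : IsGreatest (F '' {j | i + 1 ≤ j ∧ j ≤ K ∧ j / a = (i + 1) / a}) v) :
    IsGreatest (F '' {j | i ≤ j ∧ j ≤ K ∧ j / a = i / a})
      (max (v * if 0 < (i + 1) % a then 1 else 0) (F i)) := by
  have hi := succ_div_eq_iff i a
  obtain ⟨⟨j, ⟨hj1, hj2, hj3⟩, rfl⟩, hmax⟩ := h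
  split_ifs with hm
  · have hi := hi.2 hm.ne'
    refine ⟨?_, ?_⟩
    · rcases max_choice (F j * 1) (F i) with h | h <;> rw [h]
      · exact ⟨j, ⟨by omega, by omega, by omega⟩, by simp⟩
      · exact ⟨i, ⟨le_rfl, hK.le, rfl⟩, rfl⟩
    · rintro _ ⟨l, ⟨h1, h2, h3⟩, rfl⟩
      rcases h1.lt_or_eq with h1 | rfl
      · exact le_max_of_le_left (by simpa using hmax ⟨l, ⟨by omega, by omega, by omega⟩, rfl⟩)
      · exact le_max_right _ _
  · have hi : (i + 1) / a ≠ i / a := fun h => hm (Nat.pos_of_ne_zero (hi.1 h))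
    refine ⟨⟨i, ⟨le_rfl, hK.le, rfl⟩, by simp⟩, ?_⟩
    rintro _ ⟨l, ⟨h1, h2, h3⟩, rfl⟩
    rcases h1.lt_or_eq with h1 | rfl
    · have := Nat.div_le_div_right (c := a) (show i + 1 ≤ l by omega)
      have := Nat.div_le_div_right (c := a) (show i ≤ i + 1 by omega)
      omega
    · simp

/-- The maximum over a window of length `a`, from those over parts of two blocks. -/
theorem isGreatest_window {i v u : ℕ} (ha : 0 < a) (hi : i ≤ K)
    (hv : IsGreatest (F '' {j | j ≤ i ∧ j / a = i / a}) v)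
    (hu : a ≤ i + 1 →
      IsGreatest (F '' {j | i + 1 - a ≤ j ∧ j ≤ K ∧ j / a = (i + 1 - a) / a}) u)
    (hu0 : i + 1 < a → u = 0) :
    IsGreatest (F '' {j | i + 1 ≤ j + a ∧ j ≤ i}) (max u v) := by
  obtain ⟨⟨j, ⟨hj1, hj2⟩, rfl⟩, hmax⟩ := hv
  have hd := Nat.div_add_mod i a
  have hm := Nat.mod_lt i ha
  have hlt : ∀ l, l / a = i / a → i + 1 ≤ l + a := by
    intro l hl
    have := Nat.div_add_mod l a
    rw [hl] at this
    omega
  rcases Nat.lt_or_ge (i + 1) a with h | h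
  · rw [hu0 h]
    refine ⟨⟨j, ⟨by omega, hj1⟩, by simp⟩, ?_⟩
    rintro _ ⟨l, ⟨h1, h2⟩, rfl⟩
    refine le_max_of_le_right (hmax ⟨l, ⟨h2, ?_⟩, rfl⟩)
    rw [Nat.div_eq_of_lt (by omega), Nat.div_eq_of_lt (by omega)]
  · obtain ⟨⟨l, ⟨hl1, hl2, hl3⟩, rfl⟩, hmax'⟩ := hu h
    -- The block containing the left end of the window has length `a`, hence does not reach beyond
    -- `i`.
    have hblock : ∀ l, i + 1 - a ≤ l → l / a = (i + 1 - a) / a → l ≤ i := by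
      intro l h1 h2
      have h3 := Nat.div_add_mod l a
      have h4 := Nat.mod_lt l ha
      have h5 := Nat.div_add_mod (i + 1 - a) a
      have h6 := Nat.mod_lt (i + 1 - a) ha
      by_contra hcon
      have := Nat.div_le_div_right (c := a) (show i + 1 - a + a ≤ l by omega)
      rw [Nat.add_div_right _ ha] at this
      omega
    refine ⟨?_, ?_⟩
    · rcases max_choice (F l) (F j) with h' | h' <;> rw [h']
      · exact ⟨l, ⟨by omega, hblock l hl1 hl3⟩, rfl⟩
      · exact ⟨j, ⟨hlt j hj2, hj1⟩, rfl⟩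
    · rintro _ ⟨q, ⟨h1, h2⟩, rfl⟩
      by_cases hq : q / a = i / a
      · exact le_max_of_le_right (hmax ⟨q, ⟨h2, hq⟩, rfl⟩)
      · refine le_max_of_le_left (hmax' ⟨q, ⟨by omega, by omega, ?_⟩, rfl⟩)
        have h3 := Nat.div_le_div_right (c := a) h2
        have h4 := Nat.div_le_div_right (c := a) (show i + 1 - a ≤ q by omega)
        have h5 := Nat.div_le_div_right (c := a) (show i ≤ (i + 1 - a) + a by omega)
        rw [Nat.add_div_right _ ha] at h5
        omega

end Window

/-! ### Decomposition into runs of zeros. -/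

/-- The string of the runs of zeros of lengths `A t, …, A (t + j)`, separated by ones. -/
def runs (A : ℕ → ℕ) (t : ℕ) : ℕ → List Bool
  | 0 => List.replicate (A t) false
  | j + 1 => List.replicate (A t) false ++ true :: runs A (t + 1) j

theorem runs_succ (A : ℕ → ℕ) (t j : ℕ) :
    runs A t (j + 1) = runs A t j ++ true :: List.replicate (A (t + j + 1)) false := by
  induction j generalizing t with
  | zero => simp [runs]
  | succ j ih =>
    rw [runs, ih, runs, List.append_assoc, List.cons_append,
      show t + 1 + j + 1 = t + (j + 1) + 1 by omega]

theorem runs_congr {A B : ℕ → ℕ} (t j : ℕ) (h : ∀ l, l ≤ t + j → A l = B l) :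
    runs A t j = runs B t j := by
  induction j generalizing t with
  | zero => simp [runs, h t (by omega)]
  | succ j ih => rw [runs, runs, h t (by omega), ih (t + 1) fun l hl => h l (by omega)]

theorem count_true_runs (A : ℕ → ℕ) (t j : ℕ) : (runs A t j).count true = j := by
  induction j generalizing t with
  | zero => simp [runs, List.count_replicate]
  | succ j ih => simp [runs, ih, List.count_replicate]

theorem le_length_runs (A : ℕ → ℕ) {t j l : ℕ} (hl : t ≤ l) (hl' : l ≤ t + j) :
    A l ≤ (runs A t j).length := by
  induction j generalizing t with
  | zero => obtain rfl : l = t := by omega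
            simp [runs]
  | succ j ih =>
    rcases hl.eq_or_lt with rfl | h
    · simp [runs]
    · have := ih (t := t + 1) h (by omega)
      simp [runs]; omega

/-- Reading a one opens an empty run, and reading a zero (`runs_push_false`) lengthens the last run;
this is the invariant of the scan of the shorter string. -/
theorem runs_push_true {A B : ℕ → ℕ} (k : ℕ) (h : ∀ l, l ≤ k → B l = A l) (hB : B (k + 1) = 0) :
    runs B 0 (k + 1) = runs A 0 k ++ [true] := by
  rw [runs_succ, runs_congr 0 k (B := A) (by simpa using h)]
  simp [hB]

theorem runs_push_false {A B : ℕ → ℕ} (k : ℕ) (h : ∀ l, l < k → B l = A l)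
    (hB : B k = A k + 1) : runs B 0 k = runs A 0 k ++ [false] := by
  obtain _ | k := k
  · simp [runs, hB, List.replicate_succ']
  · rw [runs_succ, runs_succ, runs_congr 0 k (B := A) (fun l hl => h l (by omega))]
    simp [hB, List.replicate_succ']

/-! ### Symmetries of `L`, and the number of matching pairs. -/

theorem L_comm {α : Type*} (x y : List α) : L x y = L y x := by
  have : commonLengths x y = commonLengths y x := by
    ext k; simp only [commonLengths, Set.mem_ofPred_eq]
    exact exists_congr fun z => by tauto
  rw [L, L, this]

theorem L_map_le {α β : Type*} (f : α → β) (x y : List α) : L x y ≤ L (x.map f) (y.map f) := by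
  obtain ⟨z, h1, h2, h3⟩ := (L_isGreatest x y).1
  exact (L_isGreatest _ _).2 ⟨z.map f, h1.map f, h2.map f, by simpa using h3⟩

/-- Mapping common subsequences gives one inequality, and mapping back gives the other. Used to
exchange the two symbols. -/
theorem L_map_of_involutive {α : Type*} {f : α → α} (hf : Function.Involutive f) (x y : List α) :
    L (x.map f) (y.map f) = L x y := by
  refine le_antisymm ?_ (L_map_le f x y)
  simpa [hf.comp_self] using L_map_le f (x.map f) (y.map f)

theorem L_le_right {α : Type*} (x y : List α) : L x y ≤ y.length := by
  obtain ⟨z, -, h, h'⟩ := (L_isGreatest x y).1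
  exact h' ▸ h.length_le

theorem sum_map_get {α : Type*} (l : List α) (f : α → ℕ) :
    ∑ i : Fin l.length, f (l.get i) = (l.map f).sum := by
  rw [← List.sum_ofFn]
  congr 1
  exact List.ext_getElem (by simp) (by simp)

theorem sum_map_bool (l : List Bool) (f : Bool → ℕ) :
    (l.map f).sum = l.count true * f true + l.count false * f false := by
  induction l with
  | nil => simp
  | cons b l ih => cases b <;> simp [ih] <;> ring

theorem M_eq (x y : List Bool) :
    M x y = x.count true * y.count true + x.count false * y.count false := by
  rw [M, Finset.card_filter, Fintype.sum_prod_type]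
  have h : ∀ a : Bool, ∑ j : Fin y.length, (if a = y.get j then 1 else 0) = y.count a := by
    intro a
    rw [sum_map_get y fun b => if a = b then 1 else 0, sum_map_bool]
    cases a <;> simp
  simp only [h]
  rw [sum_map_get x fun b => y.count b, sum_map_bool]

theorem length_mul_min_count_le_M (x y : List Bool) :
    x.length * min (y.count true) (y.count false) ≤ M x y := by
  rw [M_eq, ← List.count_true_add_count_false (l := x), add_mul]
  exact Nat.add_le_add (Nat.mul_le_mul_left _ (min_le_left _ _))
    (Nat.mul_le_mul_left _ (min_le_right _ _))

theorem M_comm (x y : List Bool) : M x y = M y x := by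
  rw [M_eq, M_eq, mul_comm, mul_comm (x.count false)]

end LCS

/-! ### A structured language and its semantics. -/

namespace WordRAM

/-- The variables of the structured programs. -/
inductive Reg where
  | out | len | zero | one | two | nx | ny | bx | yb | flip | ones | bZ | bP | bQ | bA | bR | bS |
    bH | bound | gap | stage | go | cnt | ix | cur | ptr | val | bit | pos
  deriving DecidableEq

/-- The machine register of a variable (registers from `40` on are scratch space). -/
def Reg.idx : Reg → ℕ
  | .out => 0 | .len => 1 | .zero => 2 | .one => 3 | .two => 4 | .nx => 5 | .ny => 6 | .bx => 7
  | .yb => 8 | .flip => 9 | .ones => 10 | .bZ => 11 | .bP => 12 | .bQ => 13 | .bA => 14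
  | .bR => 15 | .bS => 16 | .bH => 17 | .bound => 18 | .gap => 19 | .stage => 20 | .go => 21
  | .cnt => 22 | .ix => 23 | .cur => 24 | .ptr => 25 | .val => 26 | .bit => 27 | .pos => 28

theorem Reg.idx_lt (r : Reg) : r.idx < 40 := by cases r <;> decide

theorem Reg.idx_injective : Function.Injective Reg.idx := by
  let g : ℕ → Reg := fun n => ([
    .out, .len, .zero, .one, .two, .nx, .ny, .bx, .yb, .flip, .ones, .bZ, .bP, .bQ, .bA, .bR,
    .bS, .bH, .bound, .gap, .stage, .go, .cnt, .ix, .cur, .ptr, .val, .bit, .pos] :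
    List Reg).getD n .out
  refine Function.LeftInverse.injective (g := g) fun r => ?_
  cases r <;> rfl

@[simp] theorem Reg.idx_inj {r r' : Reg} : r.idx = r'.idx ↔ r = r' := Reg.idx_injective.eq_iff

/-- The variables and the memory. -/
structure St where
  reg : Reg → ℕ
  mem : ℕ → ℕ

/-- Operations on natural numbers; `sub` is truncated subtraction. -/
inductive Fn where
  | add | sub | mul | mod | lt | eq | xor | max

def Fn.eval : Fn → ℕ → ℕ → ℕ
  | .add, a, b => a + b
  | .sub, a, b => a - b
  | .mul, a, b => a * b
  | .mod, a, b => a % b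
  | .lt, a, b => if a < b then 1 else 0
  | .eq, a, b => if a = b then 1 else 0
  | .xor, a, b => a ^^^ b
  | .max, a, b => Max.max a b

/-- Straight-line statements. -/
inductive Prim where
  | const (d : Reg) (k : ℕ)
  | move (d a : Reg)
  | op (f : Fn) (d a b : Reg)
  | load (d a : Reg)
  | store (a b : Reg)

def Prim.eval (s : St) : Prim → St
  | .const d k => ⟨Function.update s.reg d k, s.mem⟩
  | .move d a => ⟨Function.update s.reg d (s.reg a), s.mem⟩
  | .op f d a b => ⟨Function.update s.reg d (f.eval (s.reg a) (s.reg b)), s.mem⟩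
  | .load d a => ⟨Function.update s.reg d (s.mem (s.reg a)), s.mem⟩
  | .store a b => ⟨s.reg, Function.update s.mem (s.reg a) (s.reg b)⟩

/-- The value computed by the statement is less than `W`. -/
def Prim.Safe (W : ℕ) (s : St) : Prim → Prop
  | .const _ k => k < W
  | .op f _ a b => f.eval (s.reg a) (s.reg b) < W
  | _ => True

/-- The variable that a statement changes. -/
def Prim.writes (r : Reg) : Prim → Bool
  | .const d _ => d == r
  | .move d _ => d == r
  | .op _ d _ _ => d == r
  | .load d _ => d == r
  | .store _ _ => false

def Prim.code : Prim → List Instr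
  | .const d k => [.const d.idx k]
  | .move d a => [.move d.idx a.idx]
  | .op .add d a b => [.op .add d.idx a.idx b.idx]
  | .op .sub d a b =>
      [.op .lt 40 b.idx a.idx, .op .sub 41 a.idx b.idx, .op .mul d.idx 40 41]
  | .op .mul d a b => [.op .mul d.idx a.idx b.idx]
  | .op .mod d a b => [.op .mod d.idx a.idx b.idx]
  | .op .lt d a b => [.op .lt d.idx a.idx b.idx]
  | .op .eq d a b => [.op .eq d.idx a.idx b.idx]
  | .op .xor d a b => [.op .xor d.idx a.idx b.idx]
  | .op .max d a b =>
      [.op .lt 40 b.idx a.idx, .op .sub 41 a.idx b.idx, .op .mul 40 40 41, .op .add d.idx b.idx 40]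
  | .load d a => [.load d.idx a.idx]
  | .store a b => [.store a.idx b.idx]

/-- Structured programs; `loop a c` repeats `c` as long as the variable `a` is not `0`. -/
inductive Cmd where
  | block (ps : List Prim)
  | seq (c₁ c₂ : Cmd)
  | loop (a : Reg) (c : Cmd)

def Cmd.writes (r : Reg) : Cmd → Bool
  | .block ps => ps.any (Prim.writes r)
  | .seq c₁ c₂ => c₁.writes r || c₂.writes r
  | .loop _ c => c.writes r

/-- The machine code of a program that starts at position `o`. -/
def Cmd.code (o : ℕ) : Cmd → List Instr
  | .block ps => ps.flatMap Prim.code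
  | .seq c₁ c₂ => c₁.code o ++ c₂.code (o + (c₁.code o).length)
  | .loop a c =>
      .jumpIfZero a.idx (o + (c.code (o + 1)).length + 2) :: (c.code (o + 1) ++ [.jump o])

/-- The statements can be executed one after the other without overflow, and then `Q` holds. -/
def wp (W : ℕ) : List Prim → St → (St → Prop) → Prop
  | [], s, Q => Q s
  | p :: ps, s, Q => p.Safe W s ∧ wp W ps (p.eval s) Q

/-- `Exec W c s t s'`: from `s` the program `c` terminates in `s'` after `t` machine steps, without
overflow. -/
inductive Exec (W : ℕ) : Cmd → St → ℕ → St → Prop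
  | nil (s : St) : Exec W (.block []) s 0 s
  | cons {p : Prim} {ps : List Prim} {s s' : St} {t : ℕ} :
      p.Safe W s → Exec W (.block ps) (p.eval s) t s' →
        Exec W (.block (p :: ps)) s (p.code.length + t) s'
  | seq {c₁ c₂ : Cmd} {s s' s'' : St} {t₁ t₂ : ℕ} :
      Exec W c₁ s t₁ s' → Exec W c₂ s' t₂ s'' → Exec W (.seq c₁ c₂) s (t₁ + t₂) s''
  | done {a : Reg} {c : Cmd} {s : St} : s.reg a = 0 → Exec W (.loop a c) s 1 s
  | step {a : Reg} {c : Cmd} {s s' s'' : St} {t₁ t₂ : ℕ} : s.reg a ≠ 0 →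
      Exec W c s t₁ s' → Exec W (.loop a c) s' t₂ s'' →
        Exec W (.loop a c) s (1 + (t₁ + (1 + t₂))) s''

/-- `writes` is computed from the program text, so `rfl` and `decide` suffice later to show that
constants survive loops. -/
theorem Exec.frame {W : ℕ} {c : Cmd} {s s' : St} {t : ℕ} (h : Exec W c s t s') {r : Reg}
    (hr : c.writes r = false) : s'.reg r = s.reg r := by
  induction h with
  | nil => rfl
  | @cons p ps s s' t _ _ ih =>
    simp only [Cmd.writes, List.any_cons, Bool.or_eq_false_iff] at hr ih
    rw [ih hr.2]
    have h := hr.1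
    cases p
    case store => rfl
    all_goals
      simp only [Prim.writes, beq_eq_false_iff_ne, ne_eq] at h
      simp [Prim.eval, Function.update_of_ne (Ne.symm h)]
  | seq _ _ ih₁ ih₂ =>
    simp only [Cmd.writes, Bool.or_eq_false_iff] at hr
    rw [ih₂ hr.2, ih₁ hr.1]
  | done => rfl
  | step _ _ _ ih₁ ih₂ => rw [ih₂ hr, ih₁ hr]

/-! ### Correctness of the compilation. -/

section Compile

/-- A machine configuration agrees with the values of the variables. -/
def Match (s : St) (cfg : Config) : Prop :=
  (∀ r : Reg, cfg.reg r.idx = s.reg r) ∧ cfg.mem = s.mem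

/-- The list `l` is found in `P` from position `o`. -/
def CodeAt (P : List Instr) (o : ℕ) (l : List Instr) : Prop :=
  ∀ j, (h : j < l.length) → P[o + j]? = some l[j]

theorem CodeAt.append {P l l' : List Instr} {o : ℕ} (h : CodeAt P o (l ++ l')) :
    CodeAt P o l ∧ CodeAt P (o + l.length) l' := by
  refine ⟨fun j hj => ?_, fun j hj => ?_⟩
  · rw [h j (by simp; omega), List.getElem_append_left]
  · rw [Nat.add_assoc, h (l.length + j) (by simp; omega)]
    simp

theorem CodeAt.cons {P l : List Instr} {i : Instr} {o : ℕ} (h : CodeAt P o (i :: l)) :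
    P[o]? = some i ∧ CodeAt P (o + 1) l := by
  refine ⟨h 0 (by simp), fun j hj => ?_⟩
  have := h (j + 1) (by simpa using hj)
  rw [Nat.add_assoc, Nat.add_comm 1 j]
  simpa using this

theorem run_add (w : ℕ) (P : List Instr) (t₁ t₂ : ℕ) (s : Config) :
    run w P (t₁ + t₂) s = run w P t₂ (run w P t₁ s) := by
  rw [run, Nat.add_comm, Function.iterate_add_apply, run, run]

theorem run_one {w : ℕ} {P : List Instr} {s s' : Config} {i : Instr} (hi : P[s.pc]? = some i)
    (h : i.exec w s = some s') : run w P 1 s = s' := by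
  simp [run, step, hi, h]

theorem run_succ {w : ℕ} {P : List Instr} {t : ℕ} {s s' : Config} {i : Instr}
    (hi : P[s.pc]? = some i) (h : i.exec w s = some s') : run w P (t + 1) s = run w P t s' := by
  rw [Nat.add_comm, run_add, run_one hi h]

/-- Machine subtraction wraps around; multiplying by the comparison bit replaces a wrapped result by
`0`. -/
theorem tsub_spec {W a b : ℕ} (hW : 1 < W) (h : a - b < W) :
    ((if b < a then 1 else 0) % W * ((a + W - b) % W)) % W = a - b := by
  split_ifs with hba
  · rw [Nat.mod_eq_of_lt hW, one_mul, Nat.mod_mod, show a + W - b = a - b + W by omega,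
      Nat.add_mod_right, Nat.mod_eq_of_lt h]
  · simp; omega

theorem Match.update {s : St} {cfg : Config} (h : Match s cfg) (d : Reg) (v pc : ℕ) :
    Match ⟨Function.update s.reg d v, s.mem⟩ ⟨pc, Function.update cfg.reg d.idx v, cfg.mem⟩ := by
  refine ⟨fun r => ?_, h.2⟩
  simp only [Function.update_apply, Reg.idx_inj]
  split_ifs
  · rfl
  · exact h.1 r

theorem Match.scratch {s : St} {cfg : Config} (h : Match s cfg) {d : ℕ} (hd : 40 ≤ d) (v pc : ℕ) :
    Match s ⟨pc, Function.update cfg.reg d v, cfg.mem⟩ := by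
  refine ⟨fun r => ?_, h.2⟩
  have := r.idx_lt
  simp only [Function.update_apply]
  rw [if_neg (by omega)]
  exact h.1 r

theorem Prim.run_code {w : ℕ} {P : List Instr} {p : Prim} {s : St} {cfg : Config} (hw : 0 < w)
    (hs : p.Safe (2 ^ w) s) (hP : CodeAt P cfg.pc p.code) (hm : Match s cfg) :
    (run w P p.code.length cfg).pc = cfg.pc + p.code.length ∧
      Match (p.eval s) (run w P p.code.length cfg) := by
  have hW : 1 < 2 ^ w := Nat.one_lt_two_pow hw.ne'
  have single : ∀ {i : Instr} {cfg' : Config}, CodeAt P cfg.pc [i] → i.exec w cfg = some cfg' →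
      cfg'.pc = cfg.pc + 1 → Match (p.eval s) cfg' →
        (run w P [i].length cfg).pc = cfg.pc + [i].length ∧
          Match (p.eval s) (run w P [i].length cfg) := by
    intro i cfg' h1 h2 h3 h4
    rw [List.length_singleton, run_one h1.cons.1 h2]
    exact ⟨h3, h4⟩
  have hr := hm.1
  cases p with
  | const d k =>
    refine single hP rfl rfl ?_
    have hs : k < 2 ^ w := hs
    rw [Nat.mod_eq_of_lt hs]
    exact hm.update _ _ _
  | move d a =>
    refine single hP rfl rfl ?_
    rw [hr]
    exact hm.update _ _ _
  | load d a =>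
    refine single hP rfl rfl ?_
    have := hm.update d (s.mem (s.reg a)) (cfg.pc + 1)
    rw [hr, hm.2]
    simpa [Prim.eval, hm.2] using this
  | store a b =>
    refine single hP rfl rfl ⟨hr, ?_⟩
    simp [Prim.eval, hr, hm.2]
  | op f d a b =>
    have hs : f.eval (s.reg a) (s.reg b) < 2 ^ w := hs
    have fin : ∀ (v pc : ℕ), v = f.eval (s.reg a) (s.reg b) →
        Match ((Prim.op f d a b).eval s) ⟨pc, Function.update cfg.reg d.idx v, cfg.mem⟩ := by
      rintro v pc rfl
      exact hm.update _ _ _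
    have hne : ∀ r : Reg, r.idx ≠ 40 ∧ r.idx ≠ 41 := fun r => by have := r.idx_lt; omega
    cases f with
    | add | mul | mod | lt | eq | xor =>
      refine single hP rfl rfl (fin _ _ ?_)
      simp only [BinOp.eval, Fn.eval, hr] at hs ⊢
      exact Nat.mod_eq_of_lt hs
    | sub =>
      obtain ⟨h1, hP⟩ := hP.cons
      obtain ⟨h2, hP⟩ := hP.cons
      obtain ⟨h3, -⟩ := hP.cons
      simp only [Prim.code, List.length_cons, List.length_nil, Nat.zero_add]
      rw [run_succ h1 rfl, run_succ h2 rfl, run_one h3 rfl]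
      refine ⟨rfl, fun r => ?_, hm.2⟩
      by_cases hrd : r = d
      · subst hrd
        simpa [Prim.eval, Fn.eval, BinOp.eval, Function.update_apply, hne, hr] using
          tsub_spec hW hs
      · simp [Prim.eval, hne, hr, hrd]
    | max =>
      obtain ⟨h1, hP⟩ := hP.cons
      obtain ⟨h2, hP⟩ := hP.cons
      obtain ⟨h3, hP⟩ := hP.cons
      obtain ⟨h4, -⟩ := hP.cons
      simp only [Prim.code, List.length_cons, List.length_nil, Nat.zero_add]
      rw [run_succ h1 rfl, run_succ h2 rfl, run_succ h3 rfl, run_one h4 rfl]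
      refine ⟨rfl, fun r => ?_, hm.2⟩
      have hs : Max.max (s.reg a) (s.reg b) < 2 ^ w := hs
      by_cases hrd : r = d
      · subst hrd
        -- The maximum is computed as `b + (a - b)` with truncated subtraction.
        have := tsub_spec hW (show s.reg a - s.reg b < 2 ^ w by omega)
        simp only [Prim.eval, Fn.eval, BinOp.eval, Function.update_apply, hne, hr, if_true, if_false,
          show ¬ (40 = 41) by decide, this]
        rw [Nat.mod_eq_of_lt (by omega)]
        omega
      · simp [Prim.eval, hne, hr, hrd]

/-- Induction on the execution. Jump targets are absolute, so the code is indexed by its starting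
position. -/
theorem Exec.run_code {w : ℕ} {P : List Instr} {c : Cmd} {s s' : St} {t : ℕ} (hw : 0 < w)
    (h : Exec (2 ^ w) c s t s') {cfg : Config} (hP : CodeAt P cfg.pc (c.code cfg.pc))
    (hm : Match s cfg) :
    (run w P t cfg).pc = cfg.pc + (c.code cfg.pc).length ∧ Match s' (run w P t cfg) := by
  induction h generalizing cfg with
  | nil s => exact ⟨rfl, hm⟩
  | cons hs _ ih =>
    simp only [Cmd.code, List.flatMap_cons] at hP ih ⊢
    obtain ⟨h1, h2⟩ := hP.append
    obtain ⟨h3, h4⟩ := Prim.run_code hw hs h1 hm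
    rw [run_add, List.length_append, ← Nat.add_assoc, ← h3]
    exact ih (h3 ▸ h2) h4
  | seq _ _ ih₁ ih₂ =>
    simp only [Cmd.code] at hP ⊢
    obtain ⟨h1, h2⟩ := hP.append
    obtain ⟨h3, h4⟩ := ih₁ h1 hm
    rw [run_add, List.length_append, ← Nat.add_assoc, ← h3]
    exact ih₂ (h3 ▸ h2) h4
  | done ha =>
    simp only [Cmd.code] at hP ⊢
    rw [run_one hP.cons.1 rfl]
    refine ⟨?_, hm⟩
    simp [hm.1, ha]
    omega
  | @step a c s s' s'' t₁ t₂ ha _ _ ih₁ ih₂ =>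
    have hP' := hP
    simp only [Cmd.code] at hP'
    obtain ⟨h1, h2⟩ := hP'.cons
    obtain ⟨h2, h3⟩ := h2.append
    have e₁ : run w P 1 cfg = ⟨cfg.pc + 1, cfg.reg, cfg.mem⟩ := by
      refine run_one h1 ?_
      simp [Instr.exec, hm.1, ha]
    rw [run_add, run_add, e₁]
    obtain ⟨h4, h5⟩ := ih₁ (cfg := ⟨cfg.pc + 1, cfg.reg, cfg.mem⟩) h2 hm
    set cfg' := run w P t₁ ⟨cfg.pc + 1, cfg.reg, cfg.mem⟩
    have e2 : run w P 1 cfg' = ⟨cfg.pc, cfg'.reg, cfg'.mem⟩ := by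
      refine run_one (i := .jump cfg.pc) ?_ rfl
      rw [h4]
      exact h3.cons.1
    rw [run_add, e2]
    exact ih₂ (cfg := ⟨cfg.pc, cfg'.reg, cfg'.mem⟩) hP h5

theorem Exec.haltsWithin {w : ℕ} {c : Cmd} {s s' : St} {t : ℕ} (hw : 0 < w)
    (h : Exec (2 ^ w) c s t s') {cfg : Config} (hpc : cfg.pc = 0) (hm : Match s cfg) :
    HaltsWithin w (c.code 0) cfg t (s'.reg .out) := by
  obtain ⟨h1, h2⟩ := h.run_code hw (P := c.code 0) (cfg := cfg)
    (by rw [hpc]; intro j hj; simp [hj]) hm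
  refine ⟨?_, h2.1 .out⟩
  rw [WordRAM.step, h1, hpc]
  simp

end Compile

/-! ### Rules for total correctness with time bounds. -/

/-- From `s`, the program `c` terminates within `t` machine steps without overflow in a state in
which `Q` holds. -/
def Runs (W : ℕ) (c : Cmd) (s : St) (t : ℕ) (Q : St → Prop) : Prop :=
  ∃ s' t', t' ≤ t ∧ Exec W c s t' s' ∧ Q s'

/-- The program `c` did not change its constants. -/
def Frame (c : Cmd) (s s' : St) : Prop := ∀ r, c.writes r = false → s'.reg r = s.reg r

theorem Frame.refl (c : Cmd) (s : St) : Frame c s s := fun _ _ => rfl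

theorem Frame.trans {c : Cmd} {s s' s'' : St} (h : Frame c s s') (h' : Frame c s' s'') :
    Frame c s s'' := fun r hr => (h' r hr).trans (h r hr)

section Runs

variable {W : ℕ} {c c₁ c₂ : Cmd} {s : St} {t t₁ t₂ : ℕ} {Q Q' : St → Prop}

theorem Runs.mono (h : Runs W c s t₁ Q') (ht : t₁ ≤ t)
    (hQ : ∀ s', Q' s' → Frame c s s' → Q s') : Runs W c s t Q := by
  obtain ⟨s', t', h1, h2, h3⟩ := h
  exact ⟨s', t', h1.trans ht, h2, hQ s' h3 fun r hr => h2.frame hr⟩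

theorem Prim.length_code_le (p : Prim) : p.code.length ≤ 4 := by
  rcases p with _ | _ | ⟨f, _, _, _⟩ | _ | _
  case op => cases f <;> simp [Prim.code]
  all_goals simp [Prim.code]

theorem Runs.block {ps : List Prim} (h : wp W ps s Q) :
    Runs W (.block ps) s (4 * ps.length) Q := by
  induction ps generalizing s with
  | nil => exact ⟨s, 0, le_rfl, .nil s, h⟩
  | cons p ps ih =>
    obtain ⟨s', t', h1, h2, h3⟩ := ih h.2
    refine ⟨s', _, ?_, .cons h.1 h2, h3⟩
    have := p.length_code_le
    simp only [List.length_cons]; omega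

theorem Runs.seq (h₁ : Runs W c₁ s t₁ Q') (h₂ : ∀ s', Q' s' → Frame c₁ s s' → Runs W c₂ s' t₂ Q) :
    Runs W (.seq c₁ c₂) s (t₁ + t₂) Q := by
  obtain ⟨s', t', h1, h2, h3⟩ := h₁
  obtain ⟨s'', t'', h4, h5, h6⟩ := h₂ s' h3 fun r hr => h2.frame hr
  exact ⟨s'', _, Nat.add_le_add h1 h4, .seq h2 h5, h6⟩

/-- A loop with an invariant `I` and a bound `τ` on the remaining time. -/
theorem Runs.loop {a : Reg} (I : St → Prop) (τ : St → ℕ) (h0 : I s)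
    (hend : ∀ s', I s' → Frame c s s' → s'.reg a = 0 → 1 ≤ τ s' ∧ Q s')
    (hbody : ∀ s', I s' → Frame c s s' → s'.reg a ≠ 0 →
      ∃ tb, Runs W c s' tb (fun s'' => I s'' ∧ tb + 2 + τ s'' ≤ τ s')) :
    Runs W (.loop a c) s (τ s) Q := by
  -- Induction on a bound for the potential. A round costs its body plus two jumps (the test and the
  -- return); the last test accounts for `1 ≤ τ`.
  suffices H : ∀ n s', τ s' ≤ n → I s' → Frame c s s' → Runs W (.loop a c) s' (τ s') Q from
    H _ s le_rfl h0 (Frame.refl _ _)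
  intro n
  induction n with
  | zero =>
    intro s' hn hI hF
    by_cases ha : s'.reg a = 0
    · have := (hend s' hI hF ha).1; omega
    · obtain ⟨tb, s'', t', -, -, -, h⟩ := hbody s' hI hF ha
      omega
  | succ n ih =>
    intro s' hn hI hF
    by_cases ha : s'.reg a = 0
    · obtain ⟨h1, h2⟩ := hend s' hI hF ha
      exact ⟨s', 1, h1, .done ha, h2⟩
    · obtain ⟨tb, s'', t', h1, h2, h3, h4⟩ := hbody s' hI hF ha
      obtain ⟨s₃, t₃, h5, h6, h7⟩ := ih s'' (by omega) h3
        (hF.trans fun r hr => h2.frame hr)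
      exact ⟨s₃, _, by omega, .step ha h2 h6, h7⟩

/-- A loop with `N` rounds. -/
theorem Runs.rounds {a : Reg} {N tb : ℕ} (I : ℕ → St → Prop) (h0 : I 0 s)
    (ha : ∀ i s', I i s' → i ≤ N ∧ s'.reg a = N - i)
    (hbody : ∀ i s', i < N → I i s' → Frame c s s' → Runs W c s' tb (I (i + 1)))
    (hQ : ∀ s', I N s' → Frame c s s' → Q s') :
    Runs W (.loop a c) s ((tb + 2) * N + 1) Q := by
  have hN := (ha 0 s h0).2
  have h := Runs.loop (W := W) (c := c) (s := s) (a := a) (Q := Q)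
    (fun s' => ∃ i, I i s') (fun s' => (tb + 2) * s'.reg a + 1) ⟨0, h0⟩ ?_ ?_
  · simpa [hN] using h
  · rintro s' ⟨i, hi⟩ hF h0
    obtain ⟨h1, h2⟩ := ha i s' hi
    obtain rfl : i = N := by omega
    exact ⟨by omega, hQ s' hi hF⟩
  · rintro s' ⟨i, hi⟩ hF h0
    obtain ⟨h1, h2⟩ := ha i s' hi
    refine ⟨tb, (hbody i s' (by omega) hi hF).mono le_rfl fun s'' hs'' _ => ⟨⟨_, hs''⟩, ?_⟩⟩
    have h3 := (ha _ s'' hs'').2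
    rw [h2, h3, show N - i = N - (i + 1) + 1 by omega]
    ring_nf; rfl

/-- A loop with `N` rounds whose body is a block, and its initialization. -/
theorem Runs.blockLoop {a : Reg} {ps body : List Prim} {N : ℕ} (I : ℕ → St → Prop)
    (h0 : wp W ps s (I 0)) (ha : ∀ i s', I i s' → i ≤ N ∧ s'.reg a = N - i)
    (hbody : ∀ i s', i < N → I i s' →
      Frame (.seq (.block ps) (.loop a (.block body))) s s' → wp W body s' (I (i + 1)))
    (ht : 4 * ps.length + ((4 * body.length + 2) * N + 1) ≤ t)
    (hQ : ∀ s', I N s' → Frame (.seq (.block ps) (.loop a (.block body))) s s' → Q s') :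
    Runs W (.seq (.block ps) (.loop a (.block body))) s t Q := by
  have hfr : ∀ s₁ s₂, Frame (.block ps) s s₁ → Frame (.block body) s₁ s₂ →
      Frame (.seq (.block ps) (.loop a (.block body))) s s₂ := by
    intro s₁ s₂ h1 h2 r hr
    simp only [Cmd.writes, Bool.or_eq_false_iff] at hr h1 h2
    exact (h2 r hr.2).trans (h1 r hr.1)
  refine (Runs.seq (Runs.block h0) (fun s₁ h₁ hF₁ => Runs.rounds (tb := 4 * body.length) I h₁ ha
    (fun i s' hi hI hF => Runs.block (hbody i s' hi hI (hfr _ _ hF₁ hF))) fun s' hI hF =>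
      (⟨hI, hfr _ _ hF₁ hF⟩ : I N s' ∧ _))).mono ht fun s' h _ => hQ s' h.1 h.2

theorem Runs.seq_le (h₁ : Runs W c₁ s t₁ Q')
    (h₂ : ∀ s', Q' s' → Frame c₁ s s' → Runs W c₂ s' t₂ Q) (ht : t₁ + t₂ ≤ t) :
    Runs W (.seq c₁ c₂) s t Q :=
  (h₁.seq h₂).mono ht fun _ h _ => h

end Runs

/-! ### Memory layout, and the passes over one row. -/

open LCS

/-- The constants that the main phase of the program uses: the lengths of the strings, and the
addresses of the tables. -/
structure Layout (W n m : ℕ) (s : St) : Prop where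
  hn : 0 < n
  hm : m ≤ n
  hW : 128 * n < W
  zero : s.reg .zero = 0
  one : s.reg .one = 1
  two : s.reg .two = 2
  nx : s.reg .nx = n
  ny : s.reg .ny = m
  bZ : s.reg .bZ = 2 * n + 2
  bP : s.reg .bP = 2 * (2 * n + 2)
  bQ : s.reg .bQ = 3 * (2 * n + 2)
  bA : s.reg .bA = 4 * (2 * n + 2)
  bR : s.reg .bR = 5 * (2 * n + 2)
  bS : s.reg .bS = 6 * (2 * n + 2)
  bH : s.reg .bH = 7 * (2 * n + 2)

theorem Layout.frame {W n m : ℕ} {c : Cmd} {s s' : St} (h : Layout W n m s) (hF : Frame c s s')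
    (hc : ([.zero, .one, .two, .nx, .ny, .bZ, .bP, .bQ, .bA, .bR, .bS, .bH] : List Reg).all
      fun r => !c.writes r) : Layout W n m s' := by
  simp only [List.all_cons, List.all_nil, Bool.and_eq_true, Bool.not_eq_true', and_true] at hc
  obtain ⟨h1, h2, h3, h4, h5, h6, h7, h8, h9, h10, h11, h12⟩ := hc
  exact ⟨h.hn, h.hm, h.hW, (hF _ h1).trans h.zero, (hF _ h2).trans h.one, (hF _ h3).trans h.two,
    (hF _ h4).trans h.nx, (hF _ h5).trans h.ny, (hF _ h6).trans h.bZ, (hF _ h7).trans h.bP,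
    (hF _ h8).trans h.bQ, (hF _ h9).trans h.bA, (hF _ h10).trans h.bR, (hF _ h11).trans h.bS,
    (hF _ h12).trans h.bH⟩

/-- The tables of the main phase. -/
structure Tables (n : ℕ) (X : ℕ → Bool) (A : ℕ → ℕ) (k : ℕ) (mem : ℕ → ℕ) : Prop where
  Z : ∀ R ≤ n + 1, mem (2 * n + 2 + R) = zeros X R
  P : ∀ R ≤ n + 1, mem (2 * (2 * n + 2) + R) = prev X true R
  Q : IsZeroTable X n fun r => mem (3 * (2 * n + 2) + r)
  A : ∀ t ≤ k, mem (4 * (2 * n + 2) + t) = A t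
  R0 : mem (5 * (2 * n + 2)) = 0
  H0 : mem (7 * (2 * n + 2)) = 0

theorem Tables.congr {n k : ℕ} {X : ℕ → Bool} {A : ℕ → ℕ} {mem mem' : ℕ → ℕ}
    (h : Tables n X A k mem) (hk : k ≤ n)
    (hmem : ∀ p, p ≤ 5 * (2 * n + 2) → mem' p = mem p)
    (hH : mem' (7 * (2 * n + 2)) = mem (7 * (2 * n + 2))) : Tables n X A k mem' where
  Z R hR := by rw [hmem _ (by omega), h.Z R hR]
  P R hR := by rw [hmem _ (by omega), h.P R hR]
  Q R hR := by
    have := zeros_le (X := X) R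
    simp only
    rw [hmem _ (by omega)]
    exact h.Q R hR
  A t ht := by rw [hmem _ (by omega), h.A t ht]
  R0 := by rw [hmem _ (by omega), h.R0]
  H0 := by rw [hH, h.H0]

/-- The maxima over the right parts of the blocks. -/
def suffixMax : Cmd :=
  .seq (.block [.move .cnt .bound, .op .add .cnt .cnt .one, .const .cur 0])
    (.loop .cnt (.block [.op .mod .bit .cnt .gap, .op .lt .bit .zero .bit, .op .mul .cur .cur .bit,
      .op .add .ptr .bR .cnt, .op .sub .ptr .ptr .one, .load .ptr .ptr,
      .op .add .ptr .bZ .ptr, .load .ptr .ptr, .op .add .ptr .ptr .bound,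
      .op .sub .val .cnt .one, .op .sub .ptr .ptr .val, .op .max .cur .cur .ptr,
      .op .add .ptr .bH .cnt, .store .ptr .cur, .op .sub .cnt .cnt .one]))

section Stage

variable {W n m k K a : ℕ} {X : ℕ → Bool} {A T : ℕ → ℕ} {s : St}

/-- The loop descends from `K`, restarting the maximum at block ends. Entry `i` is kept at offset `i
+ 1`: offset `0` stays `0` and serves windows that protrude to the left. -/
theorem suffixMax_spec (hL : Layout W n m s) (hT : Tables n X A k s.mem) (hK : s.reg .bound = K)
    (hKn : K ≤ 2 * n) (ha : s.reg .gap = a) (han : a ≤ n)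
    (hrow : ∀ i ≤ K, s.mem (5 * (2 * n + 2) + i) = T i) (hTn : ∀ i, T i ≤ n + 1) :
    Runs W suffixMax s (64 * K + 80) fun s' =>
      (∀ i ≤ K, IsGreatest ((fun j => zeros X (T j) + K - j) ''
        {j | i ≤ j ∧ j ≤ K ∧ j / a = i / a}) (s'.mem (7 * (2 * n + 2) + (i + 1))) ∧
          s'.mem (7 * (2 * n + 2) + (i + 1)) ≤ 3 * n + 1) ∧
      ∀ p ≤ 7 * (2 * n + 2), s'.mem p = s.mem p := by
  have hW := hL.hW
  have hn := hL.hn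
  have hz := fun i => (zeros_le (X := X) (T i)).trans (hTn i)
  set F := fun j => zeros X (T j) + K - j with hF
  refine Runs.blockLoop (N := K + 1) (fun j s' => s'.reg .cnt = K + 1 - j ∧ j ≤ K + 1 ∧
      (j = 0 → s'.reg .cur = 0) ∧
      (0 < j → IsGreatest (F '' {l | K + 1 - j ≤ l ∧ l ≤ K ∧ l / a = (K + 1 - j) / a})
        (s'.reg .cur)) ∧ s'.reg .cur ≤ 3 * n + 1 ∧
      (∀ i ≤ K, K + 1 - j ≤ i → IsGreatest (F '' {j | i ≤ j ∧ j ≤ K ∧ j / a = i / a})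
        (s'.mem (7 * (2 * n + 2) + (i + 1))) ∧ s'.mem (7 * (2 * n + 2) + (i + 1)) ≤ 3 * n + 1) ∧
      ∀ p ≤ 7 * (2 * n + 2), s'.mem p = s.mem p) ?_ (fun i s' h => ⟨h.2.1, h.1⟩) ?_ ?_ ?_
  · simp [wp, Prim.eval, Prim.Safe, Fn.eval, hK, hL.one]
    and_intros <;> intros <;> omega
  · rintro j s' hj ⟨h1, h2, h3, h4, h5, h6, h7⟩ hF'
    have hL' := hL.frame hF' (by decide)
    have hK' : s'.reg .bound = K := by rw [hF' _ rfl, hK]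
    have ha' : s'.reg .gap = a := by rw [hF' _ rfl, ha]
    obtain ⟨l, hl⟩ : ∃ l, l + j = K := ⟨K - j, by omega⟩
    have hcnt : s'.reg .cnt = l + 1 := by omega
    have hcnt' : K + 1 - j = l + 1 := by omega
    have e1 : 5 * (2 * n + 2) + (l + 1) - 1 = 5 * (2 * n + 2) + l := by omega
    have e2 := hrow l (by omega)
    have e3 := hT.Z (T l) (hTn l)
    rw [← h7 _ (by omega)] at e2
    rw [← h7 _ (by have := hTn l; omega)] at e3
    have hzl := hz l
    have hTl := hTn l
    have hmod : (l + 1) % a ≤ l + 1 := Nat.mod_le _ _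
    simp only [wp, Prim.eval, Prim.Safe, Fn.eval, Function.update_self, Function.update_of_ne,
      ne_eq, reduceCtorEq, not_false_eq_true, hcnt, ha', hL'.zero, hL'.one, hL'.bR, hL'.bZ,
      hL'.bH, e1, e2, e3, hK', Nat.add_sub_cancel]
    have hkey : IsGreatest (F '' {i | l ≤ i ∧ i ≤ K ∧ i / a = l / a})
        (max (s'.reg .cur * if 0 < (l + 1) % a then 1 else 0) (F l)) := by
      rcases Nat.eq_zero_or_pos j with rfl | hj0
      · rw [h3 rfl, Nat.zero_mul]
        refine ⟨⟨l, ⟨le_rfl, by omega, rfl⟩, by simp⟩, ?_⟩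
        rintro _ ⟨i, ⟨hi1, hi2, -⟩, rfl⟩
        obtain rfl : i = l := by omega
        simp
      · have := h4 hj0
        rw [hcnt'] at this
        exact isGreatest_block_pred (by omega) this
    have hFl : zeros X (T l) + K - l = F l := rfl
    rw [hFl]
    generalize hv : max (s'.reg .cur * if 0 < (l + 1) % a then 1 else 0) (F l) = v at hkey ⊢
    have hv' : v ≤ 3 * n + 1 := by
      obtain ⟨i, -, rfl⟩ := hkey.1
      have := hz i
      simp only [F]; omega
    have hcur : (s'.reg .cur * if 0 < (l + 1) % a then 1 else 0) ≤ v := hv ▸ le_max_left _ _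
    have hFl' : F l ≤ v := hv ▸ le_max_right _ _
    have hl' : K + 1 - (j + 1) = l := by omega
    refine ⟨by omega, by split_ifs <;> omega, by omega, by omega, by omega, trivial, by omega,
      trivial, by omega, by omega, by omega, by omega, by omega, trivial, by omega, by omega,
      by omega, by simp, fun _ => hl'.symm ▸ hkey, hv', fun i hi hi' => ?_, fun p hp => ?_⟩
    · rcases Nat.lt_or_ge l i with h | h
      · rw [Function.update_of_ne (by omega)]
        exact h6 i hi (by omega)
      · obtain rfl : i = l := by omega
        rw [Function.update_self]
        exact ⟨hkey, hv'⟩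
    · rw [Function.update_of_ne (by omega), h7 p hp]
  · simp; omega
  · rintro s' ⟨h1, h2, h3, h4, h5, h6, h7⟩ hF'
    exact ⟨fun i hi => h6 i hi (by omega), h7⟩

end Stage

/-- From the row of a string to the row of the string with a run of zeros in front of it. -/
def zerosRow : Cmd :=
  .seq (.block [.const .ix 0, .const .cur 0, .move .cnt .bound, .op .add .cnt .cnt .one,
      .op .lt .pos .zero .gap])
    (.loop .cnt (.block [.op .mod .bit .ix .gap, .op .lt .bit .zero .bit, .op .mul .cur .cur .bit,
      .op .add .ptr .bR .ix, .load .ptr .ptr, .op .add .ptr .bZ .ptr, .load .ptr .ptr,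
      .op .add .ptr .ptr .bound, .op .sub .ptr .ptr .ix, .op .max .cur .cur .ptr,
      .op .add .val .ix .one, .op .add .val .val .pos, .op .sub .val .val .gap,
      .op .mul .val .val .pos, .op .add .val .bH .val, .load .val .val, .op .max .val .val .cur,
      .op .add .val .val .ix, .op .add .val .val .one, .op .sub .val .val .bound,
      .op .sub .val .val .gap, .op .mul .val .val .pos, .op .add .val .bQ .val, .load .val .val,
      .op .sub .ptr .ix .gap, .op .add .ptr .bR .ptr, .load .ptr .ptr, .op .max .val .val .ptr,
      .op .add .ptr .bS .ix, .store .ptr .val, .op .add .ix .ix .one, .op .sub .cnt .cnt .one]))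

/-- From the row of a string to the row of the string with a one in front of it. -/
def oneRow : Cmd :=
  .seq (.block [.move .cnt .bound])
    (.loop .cnt (.block [.op .add .ptr .bS .cnt, .load .val .ptr, .op .sub .ptr .ptr .one,
      .load .ptr .ptr, .op .add .val .bP .val, .load .val .val, .op .max .val .val .ptr,
      .op .add .ptr .bR .cnt, .store .ptr .val, .op .sub .cnt .cnt .one]))

/-- The row of the empty string. -/
def nilRow : Cmd :=
  .seq (.block [.move .cnt .bound, .op .add .val .nx .one])
    (.loop .cnt (.block [.op .add .ptr .bR .cnt, .store .ptr .val, .op .sub .cnt .cnt .one]))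

section Stage

variable {W n m k K a : ℕ} {X : ℕ → Bool} {A : ℕ → ℕ} {ys : List Bool} {s : St}

/-- The prefix maximum of the current block is carried along in `cur` and combined with the stored
suffix maximum. The bit `pos` tells whether `a > 0`; there are no branches, so it acts as a factor
on the two offsets. -/
theorem zerosRow_spec (hL : Layout W n m s) (hT : Tables n X A k s.mem) (hK : s.reg .bound = K)
    (hKn : K ≤ 2 * n) (ha : s.reg .gap = a) (han : a ≤ n)
    (hrow : ∀ i ≤ K, s.mem (5 * (2 * n + 2) + i) = row X n ys i)
    (hsuf : ∀ i ≤ K, IsGreatest ((fun j => zeros X (row X n ys j) + K - j) ''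
        {j | i ≤ j ∧ j ≤ K ∧ j / a = i / a}) (s.mem (7 * (2 * n + 2) + (i + 1))) ∧
          s.mem (7 * (2 * n + 2) + (i + 1)) ≤ 3 * n + 1) :
    Runs W zerosRow s (130 * K + 160) fun s' =>
      (∀ i ≤ K, s'.mem (6 * (2 * n + 2) + i) = row X n (List.replicate a false ++ ys) i) ∧
      ∀ p, p < 6 * (2 * n + 2) ∨ 7 * (2 * n + 2) ≤ p → s'.mem p = s.mem p := by
  have hW := hL.hW
  have hn := hL.hn
  have hTn := fun i => row_le (X := X) (N := n) ys i
  set T := row X n ys with hTdef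
  have hz := fun i => (zeros_le (X := X) (T i)).trans (hTn i)
  set F := fun j => zeros X (T j) + K - j with hF
  refine Runs.blockLoop (N := K + 1) (fun j s' => s'.reg .cnt = K + 1 - j ∧ j ≤ K + 1 ∧
      s'.reg .ix = j ∧ (s'.reg .pos = if 0 < a then 1 else 0) ∧
      (j = 0 → s'.reg .cur = 0) ∧
      (0 < j → IsGreatest (F '' {l | l ≤ j - 1 ∧ l / a = (j - 1) / a}) (s'.reg .cur)) ∧
      s'.reg .cur ≤ 3 * n + 1 ∧
      (∀ i < j, s'.mem (6 * (2 * n + 2) + i) = row X n (List.replicate a false ++ ys) i) ∧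
      ∀ p, p < 6 * (2 * n + 2) ∨ 7 * (2 * n + 2) ≤ p → s'.mem p = s.mem p)
      ?_ (fun i s' h => ⟨h.2.1, h.1⟩) ?_ ?_ ?_
  · simp [wp, Prim.eval, Prim.Safe, Fn.eval, hK, hL.one, hL.zero, ha]
    and_intros <;> try split_ifs
    all_goals omega
  · rintro j s' hj ⟨h1, h2, h3, h4, h5, h6, h7, h8, h9⟩ hF'
    have hL' := hL.frame hF' (by decide)
    have hK' : s'.reg .bound = K := by rw [hF' _ rfl, hK]
    have ha' : s'.reg .gap = a := by rw [hF' _ rfl, ha]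
    have e2 := hrow j (by omega)
    have e3 := hT.Z (T j) (hTn j)
    have e6 := hrow (j - a) (by omega)
    rw [← h9 _ (Or.inl (by omega))] at e2 e6
    rw [← h9 _ (Or.inl (by have := hTn j; omega))] at e3
    have hzj := hz j
    have hTj := hTn j
    have hTa := hTn (j - a)
    have hmod : j % a ≤ j := Nat.mod_le _ _
    have hkey : IsGreatest (F '' {i | i ≤ j ∧ i / a = j / a})
        (max (s'.reg .cur * if 0 < j % a then 1 else 0) (F j)) := by
      rcases Nat.eq_zero_or_pos j with rfl | hj0
      · rw [h5 rfl, Nat.zero_mul]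
        refine ⟨⟨0, ⟨le_rfl, rfl⟩, by simp⟩, ?_⟩
        rintro _ ⟨i, ⟨hi1, -⟩, rfl⟩
        obtain rfl : i = 0 := by omega
        simp
      · obtain ⟨l, rfl⟩ : ∃ l, j = l + 1 := ⟨j - 1, by omega⟩
        exact isGreatest_block_succ (h6 hj0)
    obtain ⟨v, hv⟩ : ∃ v, max (s'.reg .cur * if 0 < j % a then 1 else 0)
      (zeros X (T j) + K - j) = v := ⟨_, rfl⟩
    have hFj : zeros X (T j) + K - j = F j := rfl
    rw [← hFj, hv] at hkey
    have hv' : v ≤ 3 * n + 1 := by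
      obtain ⟨i, -, rfl⟩ := hkey.1
      have := hz i
      simp only [F]; omega
    have hcur : (s'.reg .cur * if 0 < j % a then 1 else 0) ≤ v := hv ▸ le_max_left _ _
    obtain ⟨f, hf⟩ : ∃ f, s'.reg .pos = f := ⟨_, rfl⟩
    rw [hf] at h4
    have hf1 : f ≤ 1 := by rw [h4]; split_ifs <;> omega
    have hq : (j + 1 + f - a) * f ≤ K + 1 := by
      rw [h4]; split_ifs <;> simp; omega
    obtain ⟨u, hu⟩ : ∃ u, s'.mem (7 * (2 * n + 2) + (j + 1 + f - a) * f) = u := ⟨_, rfl⟩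
    have hu' : u ≤ 3 * n + 1 := by
      rw [← hu, h9 _ (Or.inr (by omega))]
      generalize (j + 1 + f - a) * f = q at hq
      obtain _ | q := q
      · rw [Nat.add_zero, hT.H0]; omega
      · exact (hsuf q (by omega)).2
    have hw : max u v + j + 1 - K - a ≤ 6 * n + 2 := by omega
    have htf : (max u v + j + 1 - K - a) * f ≤ 6 * n + 2 :=
      (Nat.mul_le_mul_left _ hf1).trans (by omega)
    obtain ⟨z, hz'⟩ : ∃ z, s'.mem (3 * (2 * n + 2) + (max u v + j + 1 - K - a) * f) = z := ⟨_, rfl⟩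
    have hres : max z (T (j - a)) = row X n (List.replicate a false ++ ys) j ∧
        (max u v + j + 1 - K - a) * f ≤ n + 1 := by
      -- For an empty run both offsets become `0`, where the tables hold `0`, and the row is merely
      -- copied.
      rcases Nat.eq_zero_or_pos a with rfl | ha0
      · obtain rfl : f = 0 := by simpa using h4
        rw [Nat.mul_zero, Nat.add_zero, h9 _ (Or.inl (by omega))] at hz'
        have := hT.Q 0 (by omega)
        simp only [zeros, prev, Nat.add_zero, hz'] at this
        simp [this, hTdef]
      · obtain rfl : f = 1 := by rw [h4, if_pos ha0]
        rw [Nat.mul_one] at hz' hu ⊢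
        have hwin := isGreatest_window (F := F) (u := u) ha0 (show j ≤ K by omega) hkey (fun haj => ?_)
          (fun haj => ?_)
        · obtain ⟨hr1, R, hR, hr2⟩ := hT.Q.row_replicate (K := K) ha0 (by omega) hwin
          have := (zeros_le (X := X) R)
          refine ⟨?_, by omega⟩
          rw [hr1, max_comm, ← hz', h9 _ (Or.inl (by omega))]
        · rw [← hu, h9 _ (Or.inr (by omega)), show j + 1 + 1 - a = (j + 1 - a) + 1 by omega]
          exact (hsuf _ (by omega)).1
        -- Here the window protrudes to the left, and the truncated offset reads the `0` stored in
        -- front of the suffix maxima.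
        · rw [← hu, h9 _ (Or.inr (by omega)), show j + 1 + 1 - a = 0 by omega, Nat.add_zero, hT.H0]
    have hzr : max z (T (j - a)) ≤ n + 1 := hres.1 ▸ row_le _ _
    simp only [wp, Prim.eval, Prim.Safe, Fn.eval, Function.update_self, Function.update_of_ne,
      ne_eq, reduceCtorEq, not_false_eq_true, h1, h3, ha', hL'.zero, hL'.one, hL'.bR, hL'.bZ,
      hL'.bH, hL'.bS, hL'.bQ, e2, e3, e6, hK', hv, hf, hu, hz']
    refine ⟨by omega, by split_ifs <;> omega, by omega, by omega, trivial, by omega,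
      trivial, by omega, by omega, by omega, by omega, by omega, by omega, by omega, by omega,
      trivial, by omega, by omega, by omega, by omega, by omega, by omega, by omega, trivial,
      by omega, by omega, trivial, by omega, by omega, trivial, by omega, by omega, by omega,
      by omega, trivial, h4, by simp, fun _ => hkey, hv', fun i hi => ?_, fun p hp => ?_⟩
    · rcases Nat.lt_or_ge i j with h | h
      · rw [Function.update_of_ne (by omega)]
        exact h8 i h
      · obtain rfl : i = j := by omega
        rw [Function.update_self]
        exact hres.1
    · rw [Function.update_of_ne (by omega), h9 p hp]
  · simp; omega
  · rintro s' ⟨h1, h2, h3, h4, h5, h6, h7, h8, h9⟩ hF'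
    exact ⟨fun i hi => h8 i (by omega), h9⟩

theorem oneRow_spec (hL : Layout W n m s) (hT : Tables n X A k s.mem) (hK : s.reg .bound = K)
    (hKn : K ≤ 2 * n) (hrow : ∀ i ≤ K, s.mem (6 * (2 * n + 2) + i) = row X n ys i) :
    Runs W oneRow s (42 * K + 5) fun s' =>
      (∀ i ≤ K, s'.mem (5 * (2 * n + 2) + i) = row X n (true :: ys) i) ∧
      ∀ p, p ≤ 5 * (2 * n + 2) ∨ 6 * (2 * n + 2) ≤ p → s'.mem p = s.mem p := by
  have hW := hL.hW
  have hn := hL.hn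
  refine Runs.blockLoop (N := K) (fun j s' => s'.reg .cnt = K - j ∧ j ≤ K ∧
      (∀ i ≤ K, K - j < i → s'.mem (5 * (2 * n + 2) + i) = row X n (true :: ys) i) ∧
      ∀ p, p ≤ 5 * (2 * n + 2) ∨ 6 * (2 * n + 2) ≤ p → s'.mem p = s.mem p)
      ?_ (fun i s' h => ⟨h.2.1, h.1⟩) ?_ ?_ ?_
  · simp [wp, Prim.eval, Prim.Safe, hK]
    intros; omega
  · rintro j s' hj ⟨h1, h2, h3, h4⟩ hF'
    have hL' := hL.frame hF' (by decide)
    obtain ⟨l, hl⟩ : ∃ l, l + 1 + j = K := ⟨K - j - 1, by omega⟩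
    have hcnt : s'.reg .cnt = l + 1 := by omega
    have e1 : 6 * (2 * n + 2) + (l + 1) - 1 = 6 * (2 * n + 2) + l := by omega
    have e2 := hrow l (by omega)
    have e3 := hrow (l + 1) (by omega)
    have hr := row_le (X := X) (N := n) ys l
    have hr' := row_le (X := X) (N := n) ys (l + 1)
    have e4 := hT.P _ hr'
    have hp := (prev_le (X := X) true (row X n ys (l + 1)))
    rw [← h4 _ (Or.inr (by omega))] at e2 e3
    rw [← h4 _ (Or.inl (by omega))] at e4
    simp only [wp, Prim.eval, Prim.Safe, Fn.eval, Function.update_self, Function.update_of_ne,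
      ne_eq, reduceCtorEq, not_false_eq_true, hcnt, hL'.one, hL'.bR, hL'.bP, hL'.bS, e1, e2, e3, e4]
    refine ⟨by omega, trivial, by omega, trivial, by omega, trivial, by omega, by omega, trivial,
      by omega, by omega, by omega, fun i hi hi' => ?_, fun p hp => ?_⟩
    · rcases Nat.lt_or_ge (l + 1) i with h | h
      · rw [Function.update_of_ne (by omega)]
        exact h3 i hi (by omega)
      · obtain rfl : i = l + 1 := by omega
        rw [Function.update_self, row, max_comm, Nat.add_sub_cancel]
    · rw [Function.update_of_ne (by omega), h4 p hp]
  · simp; omega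
  · rintro s' ⟨h1, h2, h3, h4⟩ hF'
    refine ⟨fun i hi => ?_, h4⟩
    obtain _ | i := i
    -- Entry `0` is never written and keeps the value `0` that every row has there.
    · rw [row_zero, Nat.add_zero, h4 _ (Or.inl le_rfl), hT.R0]
    · exact h3 _ hi (by omega)

theorem nilRow_spec (hL : Layout W n m s) (hT : Tables n X A k s.mem) (hK : s.reg .bound = K)
    (hKn : K ≤ 2 * n) :
    Runs W nilRow s (14 * K + 9) fun s' =>
      (∀ i ≤ K, s'.mem (5 * (2 * n + 2) + i) = row X n [] i) ∧
      ∀ p, p ≤ 5 * (2 * n + 2) ∨ 6 * (2 * n + 2) ≤ p → s'.mem p = s.mem p := by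
  have hW := hL.hW
  have hn := hL.hn
  refine Runs.blockLoop (N := K) (fun j s' => s'.reg .cnt = K - j ∧ j ≤ K ∧
      s'.reg .val = n + 1 ∧
      (∀ i ≤ K, K - j < i → s'.mem (5 * (2 * n + 2) + i) = n + 1) ∧
      ∀ p, p ≤ 5 * (2 * n + 2) ∨ 6 * (2 * n + 2) ≤ p → s'.mem p = s.mem p)
      ?_ (fun i s' h => ⟨h.2.1, h.1⟩) ?_ ?_ ?_
  · simp [wp, Prim.eval, Prim.Safe, Fn.eval, hK, hL.nx, hL.one]
    and_intros <;> intros <;> omega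
  · rintro j s' hj ⟨h1, h2, h0, h3, h4⟩ hF'
    have hL' := hL.frame hF' (by decide)
    simp only [wp, Prim.eval, Prim.Safe, Fn.eval, Function.update_self, Function.update_of_ne,
      ne_eq, reduceCtorEq, not_false_eq_true, h0, h1, hL'.one, hL'.bR]
    refine ⟨by omega, trivial, by omega, by omega, by omega, trivial,
      fun i hi hi' => ?_, fun p hp => ?_⟩
    · rcases Nat.lt_or_ge (K - j) i with h | h
      · rw [Function.update_of_ne (by omega)]
        exact h3 i hi (by omega)
      · obtain rfl : i = K - j := by omega
        rw [Function.update_self]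
    · rw [Function.update_of_ne (by omega), h4 p hp]
  · simp; omega
  · rintro s' ⟨h1, h2, h0, h3, h4⟩ hF'
    refine ⟨fun i hi => ?_, h4⟩
    obtain _ | i := i
    · rw [row_zero, Nat.add_zero, h4 _ (Or.inl le_rfl), hT.R0]
    · simp [row, h3 _ hi (by omega)]

end Stage

/-! ### The row of the whole string, and the search for the bound. -/

def zerosStage : Cmd :=
  .seq (.block [.op .add .ptr .bA .stage, .load .gap .ptr]) (.seq suffixMax zerosRow)

/-- Computes the row of the second string up to the index `bound`. -/
def lastRow : Cmd :=
  .seq nilRow (.seq (.block [.move .stage .ones]) (.seq zerosStage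
    (.loop .stage (.seq (.block [.op .sub .stage .stage .one]) (.seq oneRow zerosStage)))))

/-- Doubles `bound` until the row of the second string is positive there. -/
def findBound : Cmd :=
  .seq (.block [.const .bound 1, .const .go 1])
    (.loop .go (.seq lastRow (.block [.op .add .ptr .bS .bound, .load .ptr .ptr,
      .op .eq .go .ptr .zero, .op .mul .ptr .bound .go, .op .add .bound .bound .ptr])))

/-- Finds the first positive entry of the row of the second string. -/
def readResult : Cmd :=
  .seq (.block [.const .ix 0, .const .go 1])
    (.seq (.loop .go (.block [.op .add .ix .ix .one, .op .add .ptr .bS .ix, .load .ptr .ptr,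
      .op .eq .go .ptr .zero])) (.block [.op .add .out .ny .one, .op .sub .out .out .ix]))

/-- The parts of the memory that the main phase only reads are the same. -/
def SameTables (n : ℕ) (mem mem' : ℕ → ℕ) : Prop :=
  ∀ p, p ≤ 5 * (2 * n + 2) ∨ p = 7 * (2 * n + 2) → mem' p = mem p

section Stage

variable {W n m k K t D : ℕ} {X : ℕ → Bool} {A : ℕ → ℕ} {ys : List Bool} {s : St}

theorem SameTables.tables {mem mem' : ℕ → ℕ} (h : SameTables n mem mem') (hk : k ≤ n)
    (hT : Tables n X A k mem) : Tables n X A k mem' :=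
  hT.congr hk (fun p hp => h p (Or.inl hp)) (h _ (Or.inr rfl))

theorem SameTables.trans {mem mem' mem'' : ℕ → ℕ} (h : SameTables n mem mem')
    (h' : SameTables n mem' mem'') : SameTables n mem mem'' :=
  fun p hp => (h' p hp).trans (h p hp)

theorem zerosStage_spec (hL : Layout W n m s) (hT : Tables n X A k s.mem)
    (hK : s.reg .bound = K) (hKn : K ≤ 2 * n) (hk : k ≤ n) (hA : ∀ t ≤ k, A t ≤ n)
    (ht : s.reg .stage = t) (htk : t ≤ k)
    (hrow : ∀ i ≤ K, s.mem (5 * (2 * n + 2) + i) = row X n ys i) :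
    Runs W zerosStage s (194 * K + 248) fun s' =>
      (∀ i ≤ K, s'.mem (6 * (2 * n + 2) + i) =
        row X n (List.replicate (A t) false ++ ys) i) ∧ SameTables n s.mem s'.mem := by
  have hW := hL.hW
  have hn := hL.hn
  refine Runs.seq_le (Q' := fun s' => s'.mem = s.mem ∧ s'.reg .gap = A t)
    (t₂ := 194 * K + 240) (Runs.block ?_) (fun s₁ ⟨h₁, h₁'⟩ hF₁ => ?_) (by simp; omega)
  · simp [wp, Prim.eval, Prim.Safe, Fn.eval, ht, hL.bA, hT.A t htk]
    omega
  have hL₁ := hL.frame hF₁ (by decide)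
  have hK₁ : s₁.reg .bound = K := by rw [hF₁ _ rfl, hK]
  rw [← h₁] at hrow hT
  refine Runs.seq_le (suffixMax_spec hL₁ hT hK₁ hKn h₁' (hA t htk) hrow fun i => row_le _ _)
    (fun s₂ ⟨h₂, h₂'⟩ hF₂ => ?_) (t₂ := 130 * K + 160) (by omega)
  refine (zerosRow_spec (hL₁.frame hF₂ (by decide))
    (hT.congr hk (fun p hp => h₂' p (by omega)) (h₂' _ le_rfl)) (by rw [hF₂ _ rfl, hK₁]) hKn
    (by rw [hF₂ _ rfl, h₁']) (hA t htk) (fun i hi => by rw [h₂' _ (by omega), hrow i hi])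
    h₂).mono le_rfl fun s₃ ⟨h₃, h₃'⟩ _ => ⟨h₃, fun p hp => ?_⟩
  rw [h₃' p (by omega), h₂' p (by omega), h₁]

/-- The runs are treated from the last to the first: after `j` rounds the row belongs to the suffix
with `j` ones. All `k + 1` passes are linear in `K`. -/
theorem lastRow_spec (hL : Layout W n m s) (hT : Tables n X A k s.mem)
    (hK : s.reg .bound = K) (hKn : K ≤ 2 * n) (hk : k ≤ n) (hA : ∀ t ≤ k, A t ≤ n)
    (hones : s.reg .ones = k) :
    Runs W lastRow s (300 * (K + 1) * (k + 1)) fun s' =>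
      (∀ i ≤ K, s'.mem (6 * (2 * n + 2) + i) = row X n (runs A 0 k) i) ∧
        SameTables n s.mem s'.mem := by
  have hW := hL.hW
  have hn := hL.hn
  refine Runs.seq_le (nilRow_spec hL hT hK hKn) (fun s₁ ⟨h₁, h₁'⟩ hF₁ => ?_)
    (t₂ := 4 + ((194 * K + 248) + ((236 * K + 259) * k + 1))) (by nlinarith)
  have hS₁ : SameTables n s.mem s₁.mem := fun p hp => h₁' p (by omega)
  have hL₁ := hL.frame hF₁ (by decide)
  have hT₁ := hS₁.tables hk hT
  have hK₁ : s₁.reg .bound = K := by rw [hF₁ _ rfl, hK]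
  have hones₁ : s₁.reg .ones = k := by rw [hF₁ _ rfl, hones]
  refine Runs.seq_le (Q' := fun s' => s'.mem = s₁.mem ∧ s'.reg .stage = k) (Runs.block ?_)
    (fun s₂ ⟨h₂, h₂'⟩ hF₂ => ?_) le_rfl
  · simp [wp, Prim.eval, Prim.Safe, hones₁]
  rw [← h₂] at h₁ hT₁ hS₁
  have hL₂ := hL₁.frame hF₂ (by decide)
  have hK₂ : s₂.reg .bound = K := by rw [hF₂ _ rfl, hK₁]
  refine Runs.seq_le (zerosStage_spec hL₂ hT₁ hK₂ hKn hk hA h₂' le_rfl h₁)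
    (fun s₃ ⟨h₃, h₃'⟩ hF₃ => ?_) le_rfl
  have hS₃ := hS₁.trans h₃'
  have hL₃ := hL₂.frame hF₃ (by decide)
  have hK₃ : s₃.reg .bound = K := by rw [hF₃ _ rfl, hK₂]
  refine Runs.rounds (tb := 236 * K + 257) (N := k) (fun j s' => j ≤ k ∧ s'.reg .stage = k - j ∧
    (∀ i ≤ K, s'.mem (6 * (2 * n + 2) + i) = row X n (runs A (k - j) j) i) ∧
    SameTables n s.mem s'.mem) ?_ (fun j s' h => ⟨h.1, h.2.1⟩) ?_ ?_
  · refine ⟨Nat.zero_le _, by rw [hF₃ _ rfl, h₂', Nat.sub_zero], fun i hi => ?_, hS₃⟩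
    rw [h₃ i hi, List.append_nil, runs, Nat.sub_zero]
  · rintro j s₄ hj ⟨-, hst, hr, hS⟩ hF₄
    have hL₄ := hL₃.frame hF₄ (by decide)
    have hK₄ : s₄.reg .bound = K := by rw [hF₄ _ rfl, hK₃]
    have hT₄ := hS.tables hk hT
    refine Runs.seq_le (Q' := fun s' => s'.mem = s₄.mem ∧ s'.reg .stage = k - (j + 1))
      (Runs.block ?_) (fun s₅ ⟨h₅, h₅'⟩ hF₅ => ?_)
      (t₂ := (42 * K + 5) + (194 * K + 248)) (by simp; omega)
    · simp [wp, Prim.eval, Prim.Safe, Fn.eval, hst, hL₄.one]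
      omega
    rw [← h₅] at hT₄ hr hS
    have hL₅ := hL₄.frame hF₅ (by decide)
    have hK₅ : s₅.reg .bound = K := by rw [hF₅ _ rfl, hK₄]
    refine Runs.seq_le (oneRow_spec hL₅ hT₄ hK₅ hKn hr) (fun s₆ ⟨h₆, h₆'⟩ hF₆ => ?_) le_rfl
    have hS₆ : SameTables n s₅.mem s₆.mem := fun p hp => h₆' p (by omega)
    refine (zerosStage_spec (hL₅.frame hF₆ (by decide)) (hS₆.tables hk hT₄)
      (by rw [hF₆ _ rfl, hK₅]) hKn hk hA (by rw [hF₆ _ rfl, h₅']) (by omega) h₆).mono le_rfl ?_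
    rintro s₇ ⟨h₇, h₇'⟩ hF₇
    refine ⟨hj, by rw [hF₇ _ rfl, hF₆ _ rfl, h₅'], fun i hi => ?_, (hS.trans hS₆).trans h₇'⟩
    rw [h₇ i hi, runs, show k - (j + 1) + 1 = k - j by omega]
  · rintro s' ⟨-, -, hr, hS⟩ -
    refine ⟨fun i hi => ?_, hS⟩
    rw [hr i hi, Nat.sub_self]

/-- A bound `K` is doubled only if `K < D ≤ n + 1`, so it stays below `2 D` and at most `2 n`. The
potential `c (4 D - K)` pays `c K` for the round with bound `K`, whether it doubles `K` or ends the
loop. -/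
theorem findBound_spec (hL : Layout W n m s) (hT : Tables n X A k s.mem) (hk : k ≤ n)
    (hA : ∀ t ≤ k, A t ≤ n) (hones : s.reg .ones = k)
    (hD : ∀ i, 0 < row X n (runs A 0 k) i ↔ D ≤ i) (hDm : D ≤ m + 1) (hD0 : 0 < D) :
    Runs W findBound s (3000 * D * (k + 1)) fun s' =>
      ∀ i ≤ D, s'.mem (6 * (2 * n + 2) + i) = row X n (runs A 0 k) i := by
  have hW := hL.hW
  have hn := hL.hn
  have hm := hL.hm
  -- As `K ≥ 1`, `300 (K + 1) (k + 1)` plus the overhead of a round is at most `700 (k + 1) K`.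
  obtain ⟨c, hc⟩ : ∃ c, c = 700 * (k + 1) := ⟨_, rfl⟩
  refine Runs.seq_le (Q' := fun s' => s'.mem = s.mem ∧ s'.reg .bound = 1 ∧ s'.reg .go = 1)
    (t₂ := c * (4 * D - 1) + 1) (Runs.block ?_)
    (fun s₁ ⟨h₁, hb₁, hg₁⟩ hF₁ => ?_) ?_
  · simp [wp, Prim.eval, Prim.Safe]
    omega
  rotate_left
  · have : c * (4 * D - 1) ≤ c * (4 * D) := Nat.mul_le_mul_left _ (Nat.sub_le _ _)
    rw [hc] at this ⊢
    simp only [List.length_cons, List.length_nil]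
    nlinarith [Nat.mul_le_mul hD0 (Nat.le_add_left 1 k)]
  have hL₁ := hL.frame hF₁ (by decide)
  have hones₁ : s₁.reg .ones = k := by rw [hF₁ _ rfl, hones]
  have hloop := Runs.loop (W := W) (a := .go) (s := s₁)
    (c := (.seq lastRow (.block [.op .add .ptr .bS .bound, .load .ptr .ptr,
      .op .eq .go .ptr .zero, .op .mul .ptr .bound .go, .op .add .bound .bound .ptr])))
    (Q := fun s' => ∀ i ≤ D, s'.mem (6 * (2 * n + 2) + i) = row X n (runs A 0 k) i)
    (fun s' => SameTables n s.mem s'.mem ∧ 0 < s'.reg .bound ∧ s'.reg .bound ≤ 2 * n ∧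
      s'.reg .bound + 1 ≤ 2 * D ∧ (s'.reg .go = 0 → ∀ i ≤ D, s'.mem (6 * (2 * n + 2) + i) =
        row X n (runs A 0 k) i))
    (fun s' => c * (if s'.reg .go = 0 then 0 else 4 * D - s'.reg .bound) + 1)
    ⟨fun p _ => by rw [h₁], by omega, by omega, by omega, by omega⟩ ?_ ?_
  · simpa [hb₁, hg₁] using hloop
  · rintro s' ⟨-, -, -, -, h⟩ - hgo
    exact ⟨Nat.le_add_left _ _, h hgo⟩
  · rintro s' ⟨hS, hb0, hb, hbD, -⟩ hF' hgo
    have hL' := hL₁.frame hF' (by decide)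
    obtain ⟨K, hK⟩ : ∃ K, s'.reg .bound = K := ⟨_, rfl⟩
    rw [hK] at hb0 hb hbD
    obtain ⟨e, he⟩ : ∃ e, 300 * (K + 1) * (k + 1) = e := ⟨_, rfl⟩
    refine ⟨e + 20, Runs.seq_le (lastRow_spec hL' (hS.tables hk hT) hK hb hk
      hA (by rw [hF' _ rfl, hones₁])) (fun s₂ ⟨h₂, h₂'⟩ hF₂ => Runs.block ?_) (he ▸ le_rfl)⟩
    have hL₂ := hL'.frame hF₂ (by decide)
    have hK₂ : s₂.reg .bound = K := by rw [hF₂ _ rfl, hK]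
    have e1 := h₂ K le_rfl
    simp only [wp, Prim.eval, Prim.Safe, Fn.eval, Function.update_self, Function.update_of_ne,
      ne_eq, reduceCtorEq, not_false_eq_true, hK₂, e1, hL₂.zero, hL₂.bS, hK, if_neg hgo]
    have hDK := hD K
    have hcost : e + 20 + 2 ≤ c * K := by
      rw [hc, ← he]
      nlinarith [Nat.mul_le_mul hb0 (Nat.le_add_left 1 k)]
    have hsplit : c * (4 * D - K) = c * (4 * D - (K + K)) + c * K := by
      rw [← Nat.mul_add]
      congr 1
      omega
    rcases Nat.eq_zero_or_pos (row X n (runs A 0 k) K) with h0 | h0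
    · have hKD : K < D := by
        by_contra hcon
        exact absurd (hDK.2 (by omega)) (by omega)
      simp only [h0, if_true, Nat.mul_one, Nat.one_ne_zero, false_implies, if_false]
      refine ⟨by omega, trivial, by omega, by omega, by omega, ⟨hS.trans h₂', by omega, by omega,
        by omega, trivial⟩, ?_⟩
      omega
    · have hKD : D ≤ K := hDK.1 h0
      simp only [h0.ne', if_true, if_false, Nat.mul_zero, Nat.add_zero, true_implies]
      refine ⟨by omega, trivial, by omega, by omega, by omega, ⟨hS.trans h₂', by omega, by omega,
        by omega, fun i hi => h₂ i (by omega)⟩, ?_⟩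
      omega

theorem readResult_spec (hL : Layout W n m s)
    (hrow : ∀ i ≤ D, s.mem (6 * (2 * n + 2) + i) = row X n ys i)
    (hD : ∀ i, 0 < row X n ys i ↔ D ≤ i) (hDm : D ≤ m + 1) (hD0 : 0 < D) :
    Runs W readResult s (40 * D) fun s' => s'.reg .out = m + 1 - D := by
  have hW := hL.hW
  have hn := hL.hn
  have hm := hL.hm
  refine Runs.seq_le (Q' := fun s' => s'.mem = s.mem ∧ s'.reg .ix = 0 ∧ s'.reg .go = 1)
    (t₂ := (18 * D + 1) + 8) (Runs.block ?_)
    (fun s₁ ⟨h₁, hi₁, hg₁⟩ hF₁ => ?_) (by simp; omega)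
  · simp [wp, Prim.eval, Prim.Safe]
    omega
  have hL₁ := hL.frame hF₁ (by decide)
  have hloop := Runs.loop (W := W) (a := .go) (s := s₁)
    (c := .block [.op .add .ix .ix .one, .op .add .ptr .bS .ix, .load .ptr .ptr,
      .op .eq .go .ptr .zero])
    (Q := fun s' => s'.reg .ix = D)
    (fun s' => s'.mem = s.mem ∧ s'.reg .ix ≤ D ∧ (s'.reg .go = 0 ↔ s'.reg .ix = D))
    (fun s' => 18 * (D - s'.reg .ix) + 1) ⟨h₁, by omega, by omega⟩
    (fun s' h _ hgo => ⟨by omega, h.2.2.1 hgo⟩) ?_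
  · simp only [hi₁, Nat.sub_zero] at hloop
    refine Runs.seq_le hloop (fun s₂ h₂ hF₂ => Runs.block ?_) le_rfl
    have hL₂ := hL₁.frame hF₂ (by decide)
    simp [wp, Prim.eval, Prim.Safe, Fn.eval, hL₂.ny, hL₂.one, h₂]
    omega
  · rintro s' ⟨h1, h2, h3⟩ hF' hgo
    have hL' := hL₁.frame hF' (by decide)
    obtain ⟨i, hi⟩ : ∃ i, s'.reg .ix = i := ⟨_, rfl⟩
    rw [hi] at h2 h3
    have hiD : i < D := by omega
    refine ⟨16, Runs.block ?_⟩
    have e1 := hrow (i + 1) hiD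
    rw [← h1] at e1
    have hDi := hD (i + 1)
    simp only [wp, Prim.eval, Prim.Safe, Fn.eval, Function.update_self, Function.update_of_ne,
      ne_eq, reduceCtorEq, not_false_eq_true, hi, e1, hL'.zero, hL'.one, hL'.bS]
    refine ⟨by omega, by omega, trivial, by split_ifs <;> omega, ⟨h1, hiD, ?_⟩, by omega⟩
    by_cases h0 : row X n ys (i + 1) = 0
    · rw [if_pos h0]
      omega
    · rw [if_neg h0]
      have := hDi.1 (Nat.pos_of_ne_zero h0)
      omega

/-- The main phase. -/
theorem findBound_readResult_spec (hL : Layout W n m s) (hT : Tables n X A k s.mem) (hk : k ≤ n)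
    (hA : ∀ t ≤ k, A t ≤ n) (hones : s.reg .ones = k)
    (hD : ∀ i, 0 < row X n (runs A 0 k) i ↔ D ≤ i) (hDm : D ≤ m + 1) (hD0 : 0 < D) :
    Runs W (.seq findBound readResult) s (3040 * D * (k + 1)) fun s' =>
      s'.reg .out = m + 1 - D :=
  Runs.seq_le (findBound_spec hL hT hk hA hones hD hDm hD0)
    (fun _ h hF => readResult_spec (hL.frame hF (by decide)) h hD hDm hD0) (by nlinarith)

end Stage

/-! ### Preprocessing. -/

/-- Finds the longer and the shorter string, and the addresses of the tables. -/
def setup : Cmd :=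
  .block [.const .one 1, .const .two 2, .op .lt .pos .out .len, .op .sub .ptr .len .out,
    .op .add .nx .out .ptr, .op .sub .ny .len .ptr, .op .mul .bx .pos .out,
    .op .sub .bit .one .pos, .op .mul .yb .bit .out, .op .add .bZ .nx .nx, .op .add .bZ .bZ .two,
    .op .add .bP .bZ .bZ, .op .add .bQ .bP .bZ, .op .add .bA .bQ .bZ, .op .add .bR .bA .bZ,
    .op .add .bS .bR .bZ, .op .add .bH .bS .bZ]

/-- Decides whether the symbols have to be exchanged, so that at most half of the symbols of the
shorter string are ones. -/
def countOnes : Cmd :=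
  .seq (.seq (.block [.move .cnt .ny, .const .cur 0])
    (.loop .cnt (.block [.op .sub .cnt .cnt .one, .op .add .ptr .yb .cnt, .load .ptr .ptr,
      .op .add .cur .cur .ptr])))
    (.block [.op .sub .ptr .ny .cur, .op .lt .flip .ptr .cur])

/-- Fills the tables for the longer string. -/
def scanLong : Cmd :=
  .seq (.block [.const .ix 0, .const .cur 0, .const .val 0, .move .cnt .nx])
    (.loop .cnt (.block [.op .add .ptr .bx .ix, .load .bit .ptr, .op .xor .bit .bit .flip,
      .op .add .ix .ix .one, .op .add .ptr .bQ .cur, .op .add .ptr .ptr .one, .store .ptr .ix,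
      .op .sub .ptr .ix .val, .op .mul .ptr .ptr .bit, .op .add .val .val .ptr,
      .op .sub .ptr .one .bit, .op .add .cur .cur .ptr,
      .op .add .ptr .bZ .ix, .op .add .ptr .ptr .one, .store .ptr .cur,
      .op .add .ptr .bP .ix, .op .add .ptr .ptr .one, .store .ptr .val, .op .sub .cnt .cnt .one]))

/-- Computes the lengths of the runs of zeros of the shorter string. -/
def scanShort : Cmd :=
  .seq (.block [.const .ix 0, .const .ones 0, .move .cnt .ny])
    (.loop .cnt (.block [.op .add .ptr .yb .ix, .load .bit .ptr, .op .xor .bit .bit .flip,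
      .op .add .ones .ones .bit, .op .add .ptr .bA .ones, .load .val .ptr,
      .op .sub .bit .one .bit, .op .add .val .val .bit, .store .ptr .val,
      .op .add .ix .ix .one, .op .sub .cnt .cnt .one]))

/-- A program for the length of a longest common subsequence of two binary strings. -/
def lcsProgram : Cmd :=
  .seq setup (.seq countOnes (.seq scanLong (.seq scanShort (.seq findBound readResult))))

/-- The variables and the memory at the start. -/
def initSt (x y : List Bool) : St where
  reg := fun r => if r = .out then x.length else if r = .len then y.length else 0
  mem := (init x y).mem

theorem match_initSt (x y : List Bool) : Match (initSt x y) (init x y) := by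
  refine ⟨fun r => ?_, rfl⟩
  cases r <;> simp [init, initSt, Reg.idx]

/-- The strings `l` (the longer one) and `v` in the memory, all of which is `0` from the tables
on. -/
structure Input (l v : List Bool) (s : St) : Prop where
  long : ∀ i < l.length, s.mem (s.reg .bx + i) = (l.getD i false).toNat
  short : ∀ i < v.length, s.mem (s.reg .yb + i) = (v.getD i false).toNat
  bx : s.reg .bx ≤ v.length
  yb : s.reg .yb ≤ l.length
  tables : ∀ p, 2 * l.length + 2 ≤ p → s.mem p = 0

/-- The longer of the two strings. -/
def longer (x y : List Bool) : List Bool := if y.length ≤ x.length then x else y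

section Preprocessing

variable {W n : ℕ} {l v : List Bool} {b : Bool} {s : St}

/-- With truncated subtraction, `|x| + (|y| - |x|)` is the maximum and `|y| - (|y| - |x|)` the
minimum of the lengths. A comparison bit times `|x|` gives each string's address. -/
theorem setup_spec {x y : List Bool} (h0 : 0 < (longer x y).length)
    (hW : 128 * (longer x y).length < W) :
    Runs W setup (initSt x y) 68 fun s' =>
      Layout W (longer x y).length (shorter x y).length s' ∧
      Input (longer x y) (shorter x y) s' := by
  have hx : ∀ i < x.length, (init x y).mem i = (x.getD i false).toNat := by
    intro i hi
    simp [init, hi, List.getElem?_append_left]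
  have hy : ∀ i < y.length, (init x y).mem (x.length + i) = (y.getD i false).toNat := by
    intro i hi
    simp [init, hi]
  have hz : ∀ p, x.length + y.length ≤ p → (init x y).mem p = 0 := by
    intro p hp
    simp [init, hp]
  refine Runs.block ?_
  simp only [wp, Prim.eval, Prim.Safe, Fn.eval, Function.update_self, Function.update_of_ne,
    ne_eq, reduceCtorEq, not_false_eq_true, initSt, if_true, if_false]
  unfold longer shorter at *
  by_cases h : y.length ≤ x.length
  · simp only [if_pos h, if_neg (Nat.not_lt.2 h)] at h0 hW ⊢
    refine ⟨by omega, by omega, by omega, by omega, by omega, by omega, by omega, by omega,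
      by omega, by omega, by omega, by omega, by omega, by omega, by omega, by omega, by omega,
      ?_, ?_⟩
    · constructor <;> (try simp) <;> omega
    · exact ⟨by simpa using hx, by simpa using hy, by simp, by simp,
        fun p hp => hz p (by omega)⟩
  · simp only [if_neg h, if_pos (Nat.lt_of_not_le h)] at h0 hW ⊢
    refine ⟨by omega, by omega, by omega, by omega, by omega, by omega, by omega, by omega,
      by omega, by omega, by omega, by omega, by omega, by omega, by omega, by omega, by omega,
      ?_, ?_⟩
    · constructor <;> (try simp) <;> omega
    · exact ⟨by simpa using hy, by simpa using hx, by simp, by simp,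
        fun p hp => hz p (by omega)⟩

theorem countOnes_spec (hL : Layout W l.length v.length s) (hI : Input l v s) :
    Runs W countOnes s (18 * v.length + 17) fun s' =>
      s'.mem = s.mem ∧ s'.reg .flip = if v.count false < v.count true then 1 else 0 := by
  have hW := hL.hW
  have hn := hL.hn
  have hm := hL.hm
  refine Runs.seq_le (Q' := fun s' => s'.mem = s.mem ∧ s'.reg .cur = v.count true)
    (t₁ := 18 * v.length + 9) (t₂ := 8)
    (Runs.blockLoop (N := v.length) (fun j s' => s'.reg .cnt = v.length - j ∧ j ≤ v.length ∧
      s'.mem = s.mem ∧ s'.reg .cur = (v.drop (v.length - j)).count true) ?_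
      (fun i s' h => ⟨h.2.1, h.1⟩) ?_ ?_ ?_) (fun s₁ ⟨h₁, h₁'⟩ hF₁ => Runs.block ?_) le_rfl
  · simp [wp, Prim.eval, Prim.Safe, hL.ny]
    omega
  · rintro j s' hj ⟨h1, h2, h3, h4⟩ hF'
    have hL' := hL.frame hF' (by decide)
    obtain ⟨q, hq⟩ : ∃ q, q + 1 + j = v.length := ⟨v.length - j - 1, by omega⟩
    have hcnt : s'.reg .cnt = q + 1 := by omega
    have hqv : q < v.length := by omega
    have hyb : s'.reg .yb = s.reg .yb := hF' _ rfl
    have e1 := hI.short q hqv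
    have hle := hI.yb
    rw [← h3, ← hyb] at e1
    have hb : (v.getD q false).toNat ≤ 1 := Bool.toNat_le _
    have hc : (v.drop (q + 1)).count true ≤ v.length :=
      List.count_le_length.trans (by simp)
    rw [show v.length - j = q + 1 by omega] at h4
    simp only [wp, Prim.eval, Prim.Safe, Fn.eval, Function.update_self, Function.update_of_ne,
      ne_eq, reduceCtorEq, not_false_eq_true, hcnt, hL'.one, e1, h4, Nat.add_sub_cancel]
    refine ⟨by omega, by omega, trivial, by omega, by omega, by omega, h3, ?_⟩
    rw [show v.length - (j + 1) = q by omega, List.drop_eq_getElem_cons hqv]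
    simp only [List.getD_eq_getElem?_getD, List.getElem?_eq_getElem hqv, Option.getD_some,
      List.count_cons]
    cases v[q] <;> simp
  · simp; omega
  · rintro s' ⟨h1, h2, h3, h4⟩ hF'
    refine ⟨h3, ?_⟩
    rw [h4]
    simp
  · have hL₁ := hL.frame (c := countOnes) (s' := s₁) (fun r hr => hF₁ r ?_) (by decide)
    · have hcount := List.count_true_add_count_false (l := v)
      simp only [wp, Prim.eval, Prim.Safe, Fn.eval, Function.update_self, Function.update_of_ne,
        ne_eq, reduceCtorEq, not_false_eq_true, h₁', hL₁.ny]
      rw [show v.length - v.count true = v.count false by omega]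
      exact ⟨by omega, by split_ifs <;> omega, h₁, rfl⟩
    · simp only [countOnes, Cmd.writes, Bool.or_eq_false_iff] at hr ⊢
      exact hr.1

theorem xor_toNat (a b : Bool) : a.toNat ^^^ b.toNat = (Bool.xor a b).toNat := by
  cases a <;> cases b <;> rfl

theorem getD_map_xor {i : ℕ} (hi : i < l.length) :
    (l.map fun a => Bool.xor a b).getD i false = Bool.xor (l.getD i false) b := by
  simp [hi]

/-- The scan writes each position provisionally as the next zero, at rank `cur + 1`. If the symbol
is a one, `cur` does not advance, and a later symbol overwrites the entry or it remains beyond the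
ranks in use. -/
theorem scanLong_spec (hL : Layout W l.length v.length s) (hI : Input l v s)
    (hb : s.reg .flip = b.toNat) {X : ℕ → Bool}
    (hX : X = fun i => (l.map fun a => Bool.xor a b).getD i false) :
    Runs W scanLong s (78 * l.length + 17) fun s' =>
      (∀ R ≤ l.length + 1, s'.mem (2 * l.length + 2 + R) = zeros X R) ∧
      (∀ R ≤ l.length + 1, s'.mem (2 * (2 * l.length + 2) + R) = prev X true R) ∧
      (∀ R ≤ l.length + 1, s'.mem (3 * (2 * l.length + 2) + zeros X R) = prev X false R) ∧
      ∀ p, p < 2 * l.length + 2 ∨ 4 * (2 * l.length + 2) ≤ p → s'.mem p = s.mem p := by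
  have hW := hL.hW
  have hn := hL.hn
  have hm := hL.hm
  have hbx := hI.bx
  have hlong := hI.long
  have htab := hI.tables
  have hXi : ∀ i < l.length, X i = Bool.xor (l.getD i false) b := by
    intro i hi
    rw [hX]
    exact getD_map_xor hi
  clear hX hI
  generalize l.length = n at *
  refine Runs.blockLoop (N := n) (fun j s' => s'.reg .cnt = n - j ∧ j ≤ n ∧ s'.reg .ix = j ∧
      s'.reg .cur = zeros X (j + 1) ∧ s'.reg .val = prev X true (j + 1) ∧
      (∀ R ≤ j + 1, s'.mem (2 * n + 2 + R) = zeros X R) ∧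
      (∀ R ≤ j + 1, s'.mem (2 * (2 * n + 2) + R) = prev X true R) ∧
      (∀ R ≤ j + 1, s'.mem (3 * (2 * n + 2) + zeros X R) = prev X false R) ∧
      ∀ p, p < 2 * n + 2 ∨ 4 * (2 * n + 2) ≤ p → s'.mem p = s.mem p)
      ?_ (fun i s' h => ⟨h.2.1, h.1⟩) ?_ ?_ ?_
  · have h01 : ∀ R ≤ 1, zeros X R = 0 ∧ ∀ b, prev X b R = 0 := by
      intro R hR
      interval_cases R <;> simp [zeros, prev]
    simp only [wp, Prim.eval, Prim.Safe, Function.update_self, Function.update_of_ne,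
      ne_eq, reduceCtorEq, not_false_eq_true, hL.nx]
    refine ⟨by omega, by omega, by omega, trivial, by omega, by omega, trivial,
      (h01 _ le_rfl).1.symm, ((h01 _ le_rfl).2 _).symm, fun R hR => ?_, fun R hR => ?_,
      fun R hR => ?_, fun _ _ => trivial⟩
    · rw [(h01 R hR).1, htab _ (by omega)]
    · rw [(h01 R hR).2, htab _ (by omega)]
    · rw [(h01 R hR).2, htab _ (by omega)]
  · rintro j s' hj ⟨h1, h2, h3, h4, h5, h6, h7, h8, h9⟩ hF'
    have hL' := hL.frame hF' (by decide)
    have hbx' : s'.reg .bx = s.reg .bx := hF' _ rfl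
    have hb' : s'.reg .flip = b.toNat := by rw [hF' _ rfl, hb]
    have e1 := hlong j hj
    rw [← h9 _ (by omega), ← hbx'] at e1
    have e2 : (l.getD j false).toNat ^^^ b.toNat = (X j).toNat := by rw [xor_toNat, hXi j hj]
    have hz := zeros_le (X := X) (j + 1)
    have hz' := zeros_le (X := X) (j + 2)
    have hp := prev_le (X := X) true (j + 1)
    have hp' := prev_le (X := X) true (j + 2)
    have e3 : zeros X (j + 1) + (1 - (X j).toNat) = zeros X (j + 2) := by
      rw [zeros]; cases X j <;> simp
    have e4 : prev X true (j + 1) + (j + 1 - prev X true (j + 1)) * (X j).toNat =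
        prev X true (j + 2) := by
      rw [prev]; cases X j <;> simp; omega
    have ht : (X j).toNat ≤ 1 := Bool.toNat_le _
    have hzm : ∀ R ≤ j + 1, zeros X R ≤ zeros X (j + 1) := fun R hR => zeros_mono hR
    simp only [wp, Prim.eval, Prim.Safe, Fn.eval, Function.update_self, Function.update_of_ne,
      ne_eq, reduceCtorEq, not_false_eq_true, h1, h3, h4, h5, hL'.one, hL'.bZ, hL'.bP, hL'.bQ,
      hb', e1, e2, e3, e4]
    refine ⟨by omega, trivial, by omega, by omega, by omega, by omega, trivial, by omega, by omega,
      by omega, by omega, by omega, by omega, by omega, trivial, by omega, by omega, trivial,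
      by omega, by omega, by omega, trivial, trivial, trivial, fun R hR => ?_, fun R hR => ?_,
      fun R hR => ?_, fun p hp => ?_⟩
    · rw [Function.update_of_ne (by omega)]
      rcases hR.lt_or_eq with h | rfl
      · rw [Function.update_of_ne (by omega), Function.update_of_ne (by omega), h6 R (by omega)]
      · rw [Function.update_apply, if_pos (by omega)]
    · rcases hR.lt_or_eq with h | rfl
      · rw [Function.update_of_ne (by omega), Function.update_of_ne (by omega),
          Function.update_of_ne (by omega), h7 R (by omega)]
      · rw [Function.update_apply, if_pos (by omega)]
    · have hzR : zeros X R ≤ R := zeros_le R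
      rw [Function.update_of_ne (by omega), Function.update_of_ne (by omega)]
      rcases hR.lt_or_eq with h | rfl
      · have := hzm R (by omega)
        rw [Function.update_of_ne (by omega), h8 R (by omega)]
      · rw [zeros, prev]
        rcases hXj : X j with _ | _
        · simp [Nat.add_assoc]
        · have := h8 (j + 1) le_rfl
          simp only [reduceCtorEq, if_false, Nat.add_zero]
          rw [Function.update_of_ne (by omega), this]
    · rw [Function.update_of_ne (by omega), Function.update_of_ne (by omega),
        Function.update_of_ne (by omega), h9 p hp]
  · simp; omega
  · rintro s' ⟨h1, h2, h3, h4, h5, h6, h7, h8, h9⟩ hF'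
    exact ⟨h6, h7, h8, h9⟩

theorem scanShort_spec (hL : Layout W n v.length s) (hyb : s.reg .yb ≤ n)
    (hshort : ∀ i < v.length, s.mem (s.reg .yb + i) = (v.getD i false).toNat)
    (htab : ∀ p, 4 * (2 * n + 2) ≤ p → s.mem p = 0) (hb : s.reg .flip = b.toNat) :
    Runs W scanShort s (46 * v.length + 13) fun s' => ∃ A : ℕ → ℕ, ∃ k ≤ v.length,
      s'.reg .ones = k ∧ (∀ t ≤ k, s'.mem (4 * (2 * n + 2) + t) = A t) ∧
      runs A 0 k = (v.map fun a => Bool.xor a b) ∧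
      (∀ p, p < 4 * (2 * n + 2) → s'.mem p = s.mem p) ∧
      ∀ p, 5 * (2 * n + 2) ≤ p → s'.mem p = 0 := by
  have hW := hL.hW
  have hn := hL.hn
  have hm := hL.hm
  refine Runs.blockLoop (N := v.length) (fun j s' => s'.reg .cnt = v.length - j ∧ j ≤ v.length ∧
      s'.reg .ix = j ∧ ∃ A : ℕ → ℕ, ∃ k ≤ j, s'.reg .ones = k ∧
      (∀ t ≤ k, s'.mem (4 * (2 * n + 2) + t) = A t) ∧
      runs A 0 k = ((v.map fun a => Bool.xor a b).take j) ∧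
      (∀ p, p < 4 * (2 * n + 2) → s'.mem p = s.mem p) ∧
      ∀ p, 4 * (2 * n + 2) + k < p → s'.mem p = 0) ?_ (fun i s' h => ⟨h.2.1, h.1⟩) ?_ ?_ ?_
  · simp only [wp, Prim.eval, Prim.Safe, Function.update_self, Function.update_of_ne,
      ne_eq, reduceCtorEq, not_false_eq_true, hL.ny]
    refine ⟨by omega, by omega, trivial, by omega, by omega, trivial, fun _ => 0, 0, le_rfl, rfl,
      fun t ht => htab _ (by omega), by simp [runs], fun _ _ => trivial, fun p hp => htab _ (by omega)⟩
  · rintro j s' hj ⟨h1, h2, h3, A, k, hkj, h4, h5, h6, h7, h8⟩ hF'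
    have hL' := hL.frame hF' (by decide)
    have hyb' : s'.reg .yb = s.reg .yb := hF' _ rfl
    have hb' : s'.reg .flip = b.toNat := by rw [hF' _ rfl, hb]
    have e1 := hshort j hj
    rw [← h7 _ (by omega), ← hyb'] at e1
    have htake : (v.map fun a => Bool.xor a b).take (j + 1) =
        (v.map fun a => Bool.xor a b).take j ++ [Bool.xor (v.getD j false) b] := by
      rw [List.take_succ_eq_append_getElem (by simpa using hj)]
      simp [hj]
    have e2 := xor_toNat (v.getD j false) b
    have hAk : A k ≤ j := by
      refine (le_length_runs A (t := 0) (j := k) (Nat.zero_le _) (by omega)).trans ?_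
      rw [h6]
      simp
    rcases hbit : Bool.xor (v.getD j false) b with _ | _
    · rw [hbit, Bool.toNat_false] at e2
      rw [hbit] at htake
      have e3 := h5 k le_rfl
      simp only [wp, Prim.eval, Prim.Safe, Fn.eval, Function.update_self, Function.update_of_ne,
        ne_eq, reduceCtorEq, not_false_eq_true, h1, h3, h4, hL'.one, hL'.bA, hb', e1, e2, e3,
        Nat.add_zero, Nat.sub_zero]
      refine ⟨by omega, trivial, by omega, by omega, by omega, trivial, by omega, by omega, trivial,
        by omega, by omega, by omega, by omega, trivial, Function.update A k (A k + 1), k,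
        by omega, rfl, fun t ht => ?_, ?_, fun p hp => ?_, fun p hp => ?_⟩
      · rcases ht.lt_or_eq with h | rfl
        · rw [Function.update_of_ne (by omega), Function.update_of_ne (by omega), h5 t ht]
        · rw [Function.update_self, Function.update_self]
      · rw [htake, ← h6]
        exact runs_push_false k (fun t ht => Function.update_of_ne ht.ne _ _)
          (Function.update_self ..)
      · rw [Function.update_of_ne (by omega), h7 p hp]
      · rw [Function.update_of_ne (by omega), h8 p hp]
    · rw [hbit, Bool.toNat_true] at e2
      rw [hbit] at htake
      -- A one opens a run whose counter has not been touched and is still `0`.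
      have e3 := h8 (4 * (2 * n + 2) + (k + 1)) (by omega)
      simp only [wp, Prim.eval, Prim.Safe, Fn.eval, Function.update_self, Function.update_of_ne,
        ne_eq, reduceCtorEq, not_false_eq_true, h1, h3, h4, hL'.one, hL'.bA, hb', e1, e2, e3,
        Nat.add_zero, Nat.sub_self]
      refine ⟨by omega, trivial, by omega, by omega, by omega, trivial, by omega, by omega, trivial,
        by omega, by omega, by omega, by omega, trivial, Function.update A (k + 1) 0, k + 1,
        by omega, rfl, fun t ht => ?_, ?_, fun p hp => ?_, fun p hp => ?_⟩
      · rcases ht.lt_or_eq with h | rfl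
        · rw [Function.update_of_ne (by omega), Function.update_of_ne (by omega),
            h5 t (by omega)]
        · rw [Function.update_self, Function.update_self]
      · rw [htake, ← h6]
        exact runs_push_true k (fun t ht => Function.update_of_ne (by omega) _ _)
          (Function.update_self ..)
      · rw [Function.update_of_ne (by omega), h7 p hp]
      · rw [Function.update_of_ne (by omega), h8 p (by omega)]
  · simp; omega
  · rintro s' ⟨h1, h2, h3, A, k, hkj, h4, h5, h6, h7, h8⟩ hF'
    refine ⟨A, k, hkj, h4, h5, ?_, h7, fun p hp => h8 p (by omega)⟩
    rw [h6, List.take_of_length_le (by simp)]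

end Preprocessing

/-! ### Assembly of the program and the two bounds. -/

theorem length_longer (x y : List Bool) : (longer x y).length = LCS.n x y := by
  unfold longer LCS.n
  split_ifs <;> omega

theorem length_shorter (x y : List Bool) : (shorter x y).length = m x y := by
  unfold shorter m
  split_ifs <;> omega

theorem L_longer_shorter (x y : List Bool) : L (longer x y) (shorter x y) = L x y := by
  unfold longer shorter
  split_ifs
  · rfl
  · exact L_comm y x

theorem lcsProgram_spec {W : ℕ} {x y : List Bool} (h0 : 0 < LCS.n x y)
    (hW : 128 * LCS.n x y < W) :
    Runs W lcsProgram (initSt x y)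
      (300 * LCS.n x y + 3040 * (delta x y + 1) *
        (min ((shorter x y).count true) ((shorter x y).count false) + 1))
      fun s' => s'.reg .out = L x y := by
  rw [← length_longer] at h0 hW
  have hLm := L_le_right (longer x y) (shorter x y)
  rw [L_longer_shorter] at hLm
  have hdelta : delta x y + 1 = (shorter x y).length + 1 - L x y := by
    rw [delta, ← length_shorter]
    omega
  rw [hdelta, ← length_longer]
  refine Runs.seq_le (setup_spec h0 hW) (fun s₁ ⟨hL₁, hI₁⟩ hF₁ => ?_)
    (t₂ := 142 * (longer x y).length + 47 + 3040 * ((shorter x y).length + 1 - L x y) *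
      (min ((shorter x y).count true) ((shorter x y).count false) + 1)) (by omega)
  rw [← L_longer_shorter x y] at hLm ⊢
  generalize longer x y = l at *
  generalize shorter x y = v at *
  have hm := hL₁.hm
  obtain ⟨b, hb⟩ : ∃ b, b = decide (v.count false < v.count true) := ⟨_, rfl⟩
  have hinv : Function.Involutive fun a => Bool.xor a b := fun a => by simp
  set f := fun a => Bool.xor a b with hf
  set D := v.length + 1 - L l v with hD
  set k := min (v.count true) (v.count false) with hk
  -- The symbols are exchanged exactly when ones are in the majority, so afterwards the ones number
  -- `k`.
  have hcount : (v.map f).count true = k := by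
    have h1 : ∀ c, (v.map f).count (f c) = v.count c :=
      fun c => List.count_map_of_injective _ _ hinv.injective _
    have h2 := h1 (f true)
    simp only [hinv true] at h2
    rw [h2, hk, hf, hb]
    by_cases h : v.count false < v.count true
    · simp [h, h.le]
    · simp [h, Nat.not_lt.1 h]
  refine Runs.seq_le (countOnes_spec hL₁ hI₁) (fun s₂ ⟨h₂, hflip₂⟩ hF₂ => ?_)
    (t₂ := 124 * l.length + 30 + 3040 * D * (k + 1)) (by omega)
  have hL₂ := hL₁.frame hF₂ (by decide)
  have hI₂ : Input l v s₂ := by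
    have e1 : s₂.reg .bx = s₁.reg .bx := hF₂ _ rfl
    have e2 : s₂.reg .yb = s₁.reg .yb := hF₂ _ rfl
    constructor <;> simp only [h₂, e1, e2]
    exacts [hI₁.long, hI₁.short, hI₁.bx, hI₁.yb, hI₁.tables]
  have hflip₂ : s₂.reg .flip = b.toNat := by
    rw [hflip₂, hb]
    split_ifs with h <;> simp [h]
  refine Runs.seq_le (scanLong_spec hL₂ hI₂ hflip₂ rfl) (fun s₃ ⟨hZ, hP, hQ, h₃⟩ hF₃ => ?_)
    (t₂ := 46 * l.length + 13 + 3040 * D * (k + 1)) (by omega)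
  have hL₃ := hL₂.frame hF₃ (by decide)
  have hyb₃ : s₃.reg .yb = s₂.reg .yb := hF₃ _ rfl
  have hyb₂ := hI₂.yb
  refine Runs.seq_le (scanShort_spec hL₃ (hyb₃ ▸ hyb₂)
    (fun i hi => by rw [hyb₃, h₃ _ (by omega), hI₂.short i hi])
    (fun p hp => by rw [h₃ p (by omega), hI₂.tables p (by omega)])
    (by rw [hF₃ _ rfl, hflip₂])) (fun s₄ h₄ hF₄ => ?_)
    (t₂ := 3040 * D * (k + 1)) (by omega)
  obtain ⟨A, k', hk', hones, hA, hruns, hsame, hzero⟩ := h₄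
  have hkk : k' = k := by
    rw [← hcount, ← count_true_runs A 0 k', hruns]
  rw [hkk] at hk' hones hA hruns
  have hT : Tables l.length (fun i => (l.map f).getD i false) A k s₄.mem := by
    refine ⟨fun R hR => ?_, fun R hR => ?_, fun R hR => ?_, hA, hzero _ le_rfl,
      hzero _ (by omega)⟩
    · rw [hsame _ (by omega), hZ R hR]
    · rw [hsame _ (by omega), hP R hR]
    · have := zeros_le (X := fun i => (l.map f).getD i false) R
      simp only
      rw [hsame _ (by omega)]
      exact hQ R hR
  refine (findBound_readResult_spec (D := D) (hL₃.frame hF₄ (by decide)) hT (by omega)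
    (fun t ht => ?_) hones (fun i => ?_) (by omega) (by omega)).mono le_rfl fun s' h _ => ?_
  · have := le_length_runs A (Nat.zero_le t) (show t ≤ 0 + k by omega)
    rw [hruns, List.length_map] at this
    omega
  -- By `row_pos_iff` the row becomes positive at `D = |v| + 1 - L`, that is, at `δ + 1`.
  · have := row_pos_iff (x := l.map f) (v.map f) i
    rw [List.length_map, List.length_map, L_map_of_involutive hinv] at this
    rw [hruns, this]
    omega
  · rw [h]
    omega

/-- The running time of `lcsProgram`. -/
theorem lcsProgram_haltsWithin {x y : List Bool} {w : ℕ} (h0 : 0 < LCS.n x y)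
    (hw : 2 ^ 7 * LCS.n x y < 2 ^ w) :
    ∃ t, HaltsWithin w (lcsProgram.code 0) (init x y) t (L x y) ∧
      t ≤ 10000 * (LCS.n x y + delta x y *
        min ((shorter x y).count true) ((shorter x y).count false)) := by
  have hw0 : 0 < w := by
    rcases Nat.eq_zero_or_pos w with rfl | h
    · simp at hw; omega
    · exact h
  obtain ⟨s', t, ht, hE, hs'⟩ := lcsProgram_spec h0 (by simpa using hw)
  refine ⟨t, hs' ▸ hE.haltsWithin hw0 rfl (match_initSt x y), ht.trans ?_⟩
  have h1 : min ((shorter x y).count true) ((shorter x y).count false) ≤ LCS.n x y := by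
    refine (min_le_left _ _).trans (List.count_le_length.trans ?_)
    rw [length_shorter]
    exact min_le_max
  have h2 : delta x y ≤ LCS.n x y := (Nat.sub_le _ _).trans min_le_max
  generalize min ((shorter x y).count true) ((shorter x y).count false) = k at *
  -- Since `δ, k ≤ n` and `1 ≤ n`, `(δ + 1)(k + 1) ≤ δ k + 3 n`.
  nlinarith

end WordRAM

namespace LCS

theorem n_mul_min_count_le_M (x y : List Bool) :
    n x y * min ((shorter x y).count true) ((shorter x y).count false) ≤ M x y := by
  unfold n shorter
  split_ifs with h
  · rw [max_eq_left h]
    exact length_mul_min_count_le_M x y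
  · rw [max_eq_right (Nat.le_of_not_le h), M_comm]
    exact length_mul_min_count_le_M y x

end LCS

theorem binaryLCSSolvableInTime_of_le {T : List Bool → List Bool → ℝ}
    (hT : ∀ x y, 0 < LCS.n x y → ((LCS.n x y + LCS.delta x y *
      min ((LCS.shorter x y).count true) ((LCS.shorter x y).count false) : ℕ) : ℝ) ≤ T x y) :
    BinaryLCSSolvableInTime T := by
  -- `2 ^ 7 = 128` is the factor in `128 n < W`, which leaves room for eight areas of `2 n + 2`
  -- cells and for all intermediate values.
  refine ⟨WordRAM.lcsProgram.code 0, 7, 10000, fun x y w h0 hw => ?_⟩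
  obtain ⟨t, h1, h2⟩ := WordRAM.lcsProgram_haltsWithin h0 hw
  refine ⟨t, h1, le_trans ?_ (mul_le_mul_of_nonneg_left (hT x y h0) (by norm_num))⟩
  exact_mod_cast h2

theorem theorem4 :
    BinaryLCSSolvableInTime
        (fun x y => LCS.n x y + LCS.delta x y * LCS.M x y / LCS.n x y) ∧
      BinaryLCSSolvableInTime
        (fun x y => LCS.n x y + LCS.delta x y * (LCS.shorter x y).count true) := by
  refine ⟨binaryLCSSolvableInTime_of_le fun x y h0 => ?_,
    binaryLCSSolvableInTime_of_le fun x y h0 => ?_⟩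
  · have hn : (0 : ℝ) < LCS.n x y := by exact_mod_cast h0
    have hM : (LCS.n x y : ℝ) * (min ((LCS.shorter x y).count true)
        ((LCS.shorter x y).count false) : ℕ) ≤ LCS.M x y := by
      exact_mod_cast LCS.n_mul_min_count_le_M x y
    rw [Nat.cast_add, Nat.cast_mul, mul_div_assoc]
    refine add_le_add_right (mul_le_mul_of_nonneg_left ?_ (Nat.cast_nonneg _)) _
    rw [le_div_iff₀ hn, mul_comm]
    exact hM
  · have := Nat.mul_le_mul_left (LCS.delta x y) (min_le_left ((LCS.shorter x y).count true)
      ((LCS.shorter x y).count false))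
    exact_mod_cast Nat.add_le_add_left this _
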